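/- A \emph{sandpile} $S$ is a finite connected loopless multigraph with a distinguished vertex $s$, the sink; let $V_o$ be the set of the other (ordinary) vertices, and assume that the graph obtained by deleting $s$ is connected. Let $d(v)$ be the number of edges at $v$. A configuration is a map $c\colon V_o\to\mathbb{N}$. An ordinary vertex $v$ with $c(v)\ge d(v)$ may topple: it loses $d(v)$ particles and every ordinary neighbour gains one particle for each edge it shares with $v$; $c$ is stable if no vertex can topple. A configuration is recurrent if it can be obtained from every configuration by adding particles and then performing topplings. The \emph{transience class} $\mathrm{tcl}(S)$ is the maximum number of particles that can be added one by one, starting from the empty configuration and stabilizing after every addition, before a recurrent configuration is reached (it is $0$ if the empty configuration is already recurrent). For $w\in V_o$ let $\pi_w$ be the function on the vertices with $\pi_w(s)=0$, $\pi_w(w)=1$ that is harmonic at all other vertices (edges counted with multiplicity). There is a polynomial-time algorithm that approximates the transience class of sandpiles of bounded degree up to constant factors. Precisely: there are an algorithm (a random access machine program, with logarithmic cost) and a polynomial $T$, and for every $\Delta$ a constant $C\ge 1$ depending only on $\Delta$, such that for every sandpile $S$ as above all of whose ordinary vertices have degree at most $\Delta$, given by its sink and its adjacency matrix with multiplicities,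 the algorithm halts in time at most $T(\text{length of the input})$ and outputs a rational number $A\ge 0$ with $$\tfrac1C\,A\;\le\;\mathrm{tcl}(S)\;\le\;C\,A ,$$ in particular $\mathrm{tcl}(S)$ is finite. Moreover, whenever $\mathrm{tcl}(S)>0$, the output is obtained from the harmonic potentials of all pairs: $$A=\max_{v,w\in V_o}\ \frac{1}{\pi_w(v)}\sum_{u\in V_o}\pi_w(u).$$ -/

import Mathlib

/-! ## Abelian sandpiles -/

/-- A loopless multigraph on `V`: `mult u v` is the number of edges joining `u` and `v`. -/
structure Multigraph (V : Type) where
  mult : V → V → ℕ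
  mult_comm : ∀ u v, mult u v = mult v u
  mult_self : ∀ v, mult v v = 0

/-- The underlying simple graph: two vertices are adjacent if at least one edge joins them. -/
def Multigraph.graph {V : Type} (G : Multigraph V) : SimpleGraph V where
  Adj u v := 0 < G.mult u v
  symm := ⟨fun u v h => by rw [G.mult_comm v u]; exact h⟩
  loopless := ⟨fun v h => by rw [G.mult_self v] at h; exact lt_irrefl 0 h⟩

/-- A sandpile: a connected multigraph with a distinguished sink. -/
structure Sandpile (V : Type) extends Multigraph V where
  sink : V
  connected : toMultigraph.graph.Connected

namespace Sandpile

variable {V : Type}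

/-- The ordinary (non-sink) vertices. -/
abbrev Ordinary (S : Sandpile V) : Type := {v : V // v ≠ S.sink}

/-- A configuration: the number of particles on each ordinary vertex. -/
abbrev Config (S : Sandpile V) : Type := S.Ordinary → ℕ

/-- The graph obtained by deleting the sink is connected. -/
def ConnectedOffSink (S : Sandpile V) : Prop :=
  (S.graph.induce {v | v ≠ S.sink}).Preconnected

variable [Fintype V] [DecidableEq V]

/-- Number of edges at `v` (edges to the sink included). -/
def degree (S : Sandpile V) (v : V) : ℕ := ∑ u, S.mult v u

/-- No ordinary vertex can topple. -/
def Stable (S : Sandpile V) (c : S.Config) : Prop := ∀ v, c v < S.degree v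

/-- The result of toppling `v` once (to be used when `v` is unstable). -/
def topple (S : Sandpile V) (v : S.Ordinary) (c : S.Config) : S.Config :=
  fun u => if u = v then c u - S.degree v else c u + S.mult v u

/-- One legal toppling. -/
def TopplesTo (S : Sandpile V) (c c' : S.Config) : Prop :=
  ∃ v : S.Ordinary, S.degree v ≤ c v ∧ c' = S.topple v c

/-- There is a (possibly empty) toppling sequence from `c` to `c'`. -/
def Relaxes (S : Sandpile V) (c c' : S.Config) : Prop :=
  Relation.ReflTransGen S.TopplesTo c c'

/-- `c'` can be obtained from `c` by adding particles and then toppling. -/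
def Reachable (S : Sandpile V) (c c' : S.Config) : Prop := ∃ d, c ≤ d ∧ S.Relaxes d c'

/-- A configuration is recurrent if it is reachable from every configuration. -/
def Recurrent (S : Sandpile V) (c : S.Config) : Prop := ∀ c', S.Reachable c' c

/-- `S.TransientRun k c`: starting from the empty configuration, `k` particles can be added one
by one, stabilizing after each addition, so that `c` is obtained and no configuration met on the
way (first and last included) is recurrent. -/
inductive TransientRun (S : Sandpile V) : ℕ → S.Config → Prop
  | empty : ¬ S.Recurrent 0 → TransientRun S 0 0
  | add {k : ℕ} {c c' : S.Config} (v : S.Ordinary) :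
      TransientRun S k c → S.Relaxes (c + Pi.single v 1) c' → S.Stable c' →
      ¬ S.Recurrent c' → TransientRun S (k + 1) c'

/-- The transience class: the maximum number of particles that can be added before a recurrent
configuration is reached (`⊤` if there is no bound, `0` if the empty configuration is already
recurrent). -/
noncomputable def tcl (S : Sandpile V) : ℕ∞ :=
  ⨆ k ∈ {k : ℕ | ∃ c, S.TransientRun k c}, (k : ℕ∞)

/-- `π` is the potential with poles `w` (value `1`) and the sink (value `0`): it is harmonic at
every other vertex, edges being counted with multiplicity. -/
def IsPotential (S : Sandpile V) (w : S.Ordinary) (π : V → ℝ) : Prop :=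
  π S.sink = 0 ∧ π w = 1 ∧
    ∀ v : V, v ≠ S.sink → v ≠ w → (∑ u, (S.mult v u : ℝ) * π u) / (S.degree v : ℝ) = π v

/-- The values `(1 / π_w(v)) * ∑ u, π_w(u)`, where `(v, w)` runs over all pairs of ordinary
vertices and `π_w` is the potential with poles `w` and the sink. -/
def potentialEstimates (S : Sandpile V) : Set ℝ :=
  {r | ∃ (v w : S.Ordinary) (π : V → ℝ), S.IsPotential w π ∧
    r = 1 / π v * ∑ u : S.Ordinary, π u}

end Sandpile

/-! ## Random access machine programs with logarithmic cost

A machine has integer registers `reg x` and memory banks whose cells `mem a i` are addressed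
indirectly. A program mentions finitely many registers and banks. Every value that is computed,
read or used as an address is charged its bit length. -/

namespace RAM

/-- Machine states. -/
structure State where
  reg : ℕ → ℤ
  mem : ℕ → ℕ → ℤ

/-- Write `z` into register `x`. -/
def State.setReg (s : State) (x : ℕ) (z : ℤ) : State :=
  ⟨Function.update s.reg x z, s.mem⟩

/-- Write `z` into cell `i` of bank `a`. -/
def State.setMem (s : State) (a i : ℕ) (z : ℤ) : State :=
  ⟨s.reg, Function.update s.mem a (Function.update (s.mem a) i z)⟩

/-- Arithmetic expressions. -/
inductive Expr
  | const (z : ℤ)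
  | reg (x : ℕ)
  | load (a : ℕ) (i : Expr)
  | add (e f : Expr)
  | sub (e f : Expr)
  | mul (e f : Expr)
  | div (e f : Expr)

/-- The value of an expression. Division is rounded integer division, with value `0` if the
divisor is `0`; a negative address is read as address `0`. -/
def Expr.eval (s : State) : Expr → ℤ
  | .const z => z
  | .reg x => s.reg x
  | .load a i => s.mem a (i.eval s).toNat
  | .add e f => e.eval s + f.eval s
  | .sub e f => e.eval s - f.eval s
  | .mul e f => e.eval s * f.eval s
  | .div e f => e.eval s / f.eval s

/-- Cost of handling an integer: one plus the number of its binary digits. -/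
def wordCost (z : ℤ) : ℕ := 1 + z.natAbs.size

/-- The cost of evaluating an expression: the sum of the word costs of the values of all its
subexpressions, so that operands, addresses and results are all charged. -/
def Expr.cost (s : State) : Expr → ℕ
  | .const z => wordCost z
  | .reg x => wordCost (s.reg x)
  | .load a i => i.cost s + wordCost (s.mem a (i.eval s).toNat)
  | .add e f => e.cost s + f.cost s + wordCost (e.eval s + f.eval s)
  | .sub e f => e.cost s + f.cost s + wordCost (e.eval s - f.eval s)
  | .mul e f => e.cost s + f.cost s + wordCost (e.eval s * f.eval s)
  | .div e f => e.cost s + f.cost s + wordCost (e.eval s / f.eval s)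

/-- Programs. The tests of conditionals and loops are `0 < e`. -/
inductive Program
  | skip
  | assign (x : ℕ) (e : Expr)
  | store (a : ℕ) (i e : Expr)
  | seq (P Q : Program)
  | ite (e : Expr) (P Q : Program)
  | loop (e : Expr) (P : Program)

/-- `Exec P s s' t`: started in state `s`, the program `P` halts in state `s'` after running for
time `t`. -/
inductive Exec : Program → State → State → ℕ → Prop
  | skip (s : State) : Exec .skip s s 1
  | assign (s : State) (x : ℕ) (e : Expr) :
      Exec (.assign x e) s (s.setReg x (e.eval s)) (1 + e.cost s)
  | store (s : State) (a : ℕ) (i e : Expr) :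
      Exec (.store a i e) s
        (s.setMem a (i.eval s).toNat (e.eval s))
        (1 + i.cost s + e.cost s)
  | seq {P Q : Program} {s s' s'' : State} {t t' : ℕ} :
      Exec P s s' t → Exec Q s' s'' t' → Exec (.seq P Q) s s'' (1 + t + t')
  | ite_pos {e : Expr} {P Q : Program} {s s' : State} {t : ℕ} :
      0 < e.eval s → Exec P s s' t → Exec (.ite e P Q) s s' (1 + e.cost s + t)
  | ite_neg {e : Expr} {P Q : Program} {s s' : State} {t : ℕ} :
      ¬ 0 < e.eval s → Exec Q s s' t → Exec (.ite e P Q) s s' (1 + e.cost s + t)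
  | loop_done {e : Expr} {P : Program} {s : State} :
      ¬ 0 < e.eval s → Exec (.loop e P) s s (1 + e.cost s)
  | loop_step {e : Expr} {P : Program} {s s' s'' : State} {t t' : ℕ} :
      0 < e.eval s → Exec P s s' t → Exec (.loop e P) s' s'' t' →
      Exec (.loop e P) s s'' (1 + e.cost s + t + t')

end RAM

namespace Sandpile

/-- The initial machine state for a sandpile with vertices `0, …, n - 1`: register `0` holds `n`,
register `1` holds the sink, bank `0` holds the adjacency matrix (with multiplicities) row by
row, and everything else is `0`. -/
def input {n : ℕ} (S : Sandpile (Fin n)) : RAM.State where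
  reg x := if x = 0 then (n : ℤ) else if x = 1 then (S.sink : ℤ) else 0
  mem a k :=
    if h : a = 0 ∧ k < n * n then
      (S.mult (Fin.divNat ⟨k, h.2⟩) (Fin.modNat ⟨k, h.2⟩) : ℤ)
    else 0

/-- The length of the input in binary. -/
def inputSize {n : ℕ} (S : Sandpile (Fin n)) : ℕ :=
  RAM.wordCost n + RAM.wordCost (S.sink : ℕ) + ∑ i, ∑ j, RAM.wordCost (S.mult i j)

end Sandpile

/-!
Let `G` be the inverse of the reduced Laplacian (`green`), so that `π_w(u) = G w u / G w w` and the
potential estimates are the ratios `(∑ u, G w u) / G w v`. Toppling any vertex but `w` leaves the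
weight `∑ u, G w u * c u` of a configuration unchanged.

Upper bound: before a recurrent configuration is reached, some vertex `w` has never toppled, since
by the burning test a configuration all of whose vertices have toppled is recurrent. Every particle
ever added carries weight at least `min_v G w v`, and the total is at most `Δ * ∑ u, G w u`.

Lower bound: add all particles at the vertex `v` of the maximizing pair `(v, w)`. The weight with
pole `w` never increases and grows by at most `G w v` per particle, whereas a recurrent
configuration has a particle at one end of every edge, and by Harnack's inequality between adjacent
vertices this forces its weight to be at least a constant fraction of `∑ u, G w u`.

The ratios of entries of `G` are ratios of entries of the adjugate of the reduced Laplacian, which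
fraction-free elimination computes exactly. Its intermediate numbers are again minors, so their
length is polynomial in that of the input.
-/

/-! ## Fraction-free matrix inversion -/

section MatrixInversion

open Matrix

variable {ι R : Type*} [DecidableEq ι]

/-- The matrix whose rows indexed by `s` are those of `A`, the others being those of `B`. -/
def mixRows (s : Finset ι) (A B : Matrix ι ι R) : Matrix ι ι R := .of (s.piecewise A B)

theorem mixRows_of_mem {s : Finset ι} {i : ι} (hi : i ∈ s) (A B : Matrix ι ι R) :
    mixRows s A B i = A i :=
  s.piecewise_eq_of_mem A B hi

theorem mixRows_of_notMem {s : Finset ι} {i : ι} (hi : i ∉ s) (A B : Matrix ι ι R) :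
    mixRows s A B i = B i :=
  s.piecewise_eq_of_notMem A B hi

theorem mixRows_empty (A B : Matrix ι ι R) : mixRows ∅ A B = B :=
  Finset.piecewise_empty A B

theorem mixRows_insert (s : Finset ι) (k : ι) (A B : Matrix ι ι R) :
    mixRows (insert k s) A B = (mixRows s A B).updateRow k (A k) :=
  s.piecewise_insert A B k

theorem forall_mixRows {p : R → Prop} {A B : Matrix ι ι R} (hA : ∀ i j, p (A i j))
    (hB : ∀ i j, p (B i j)) (s : Finset ι) (i j : ι) : p (mixRows s A B i j) := by
  by_cases hi : i ∈ s
  · rw [mixRows_of_mem hi]; exact hA i j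
  · rw [mixRows_of_notMem hi]; exact hB i j

theorem mixRows_univ [Fintype ι] (A B : Matrix ι ι R) : mixRows Finset.univ A B = A :=
  Finset.piecewise_univ A B

variable [CommRing R]

/-- The fraction-free exchange step with pivot entry `(k, k)`, before its division by `d`, the
previous pivot. -/
def exchangeStep (a : Matrix ι ι R) (d : R) (k : ι) : Matrix ι ι R := fun i j =>
  if i = k then if j = k then d * d else -(d * a k j)
  else if j = k then d * a i k else a k k * a i j - a i k * a k j

theorem exchangeStep_row_pivot (a : Matrix ι ι R) (d : R) (k : ι) :
    exchangeStep a d k k = (d * d + d * a k k) • Pi.single k 1 - d • a k := by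
  ext j
  by_cases hj : j = k
  · subst hj; simp [exchangeStep]
  · simp [exchangeStep, hj]

theorem exchangeStep_row (a : Matrix ι ι R) (d : R) {i k : ι} (hi : i ≠ k) :
    exchangeStep a d k i = a k k • a i - a i k • a k + (d * a i k) • Pi.single k 1 := by
  ext j
  by_cases hj : j = k
  · subst hj; simp [exchangeStep, hi]; ring
  · simp [exchangeStep, hi, hj]

variable [Fintype ι]

theorem det_updateRow_eq_sum_mul_adjugate (M : Matrix ι ι R) (k : ι) (r : ι → R) :
    (M.updateRow k r).det = ∑ j, r j * M.adjugate j k := by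
  rw [det_eq_sum_mul_adjugate_row _ k]
  simp only [updateRow_self, adjugate_apply, updateRow_idem]

theorem vecMul_updateRow (x : ι → R) (M : Matrix ι ι R) (k : ι) (r : ι → R) :
    x ᵥ* M.updateRow k r = x ᵥ* M + x k • (r - M k) := by
  have hM : M.updateRow k r = M + vecMulVec (Pi.single k 1) (r - M k) := by
    ext i j
    by_cases hi : i = k
    · subst hi; simp [vecMulVec_apply]
    · simp [vecMulVec_apply, hi]
  simp [hM, vecMul_add, vecMul_vecMulVec]

theorem exchangeStep_mul_updateRow {M N : Matrix ι ι R} {k : ι} (hM : M k = Pi.single k 1) :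
    exchangeStep (N * M.adjugate) M.det k * M.updateRow k (N k) =
      (M.det * (M.updateRow k (N k)).det) • N.updateRow k (Pi.single k 1) := by
  set a := N * M.adjugate with ha
  have hpivot : (M.updateRow k (N k)).det = a k k := by
    rw [det_updateRow_eq_sum_mul_adjugate, ha, mul_apply]
  have haM : a * M = M.det • N := by
    rw [ha, Matrix.mul_assoc, adjugate_mul, Matrix.mul_smul, Matrix.mul_one]
  have hrow (i : ι) :
      a i ᵥ* M.updateRow k (N k) = M.det • N i + a i k • (N k - Pi.single k 1) := by
    rw [vecMul_updateRow, hM, ← mul_apply_eq_vecMul, haM]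
    rfl
  have hsingle : (Pi.single k 1 : ι → R) ᵥ* M.updateRow k (N k) = N k := by
    rw [single_one_vecMul]
    exact updateRow_self
  rw [hpivot]
  refine funext fun i => ?_
  rw [mul_apply_eq_vecMul]
  by_cases hi : i = k
  · subst hi
    rw [exchangeStep_row_pivot, sub_vecMul, smul_vecMul, smul_vecMul, hrow, hsingle]
    change _ = (M.det * a i i) • N.updateRow i (Pi.single i 1) i
    rw [updateRow_self]
    module
  · rw [exchangeStep_row _ _ hi, add_vecMul, sub_vecMul, smul_vecMul, smul_vecMul, smul_vecMul,
      hrow, hrow, hsingle]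
    change _ = (M.det * a k k) • N.updateRow k (Pi.single k 1) i
    rw [updateRow_ne hi]
    module

/-- The tableau reached from `A` by fraction-free exchange steps with pivots in `s`. -/
def partialAdjugate (A : Matrix ι ι R) (s : Finset ι) : Matrix ι ι R :=
  mixRows s 1 A * (mixRows s A 1).adjugate

theorem partialAdjugate_empty (A : Matrix ι ι R) : partialAdjugate A ∅ = A := by
  simp [partialAdjugate, mixRows_empty]

theorem partialAdjugate_univ (A : Matrix ι ι R) : partialAdjugate A Finset.univ = A.adjugate := by
  simp [partialAdjugate, mixRows_univ]

theorem det_mixRows_insert (A : Matrix ι ι R) {s : Finset ι} {k : ι} (hk : k ∉ s) :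
    (mixRows (insert k s) A 1).det = partialAdjugate A s k k := by
  rw [mixRows_insert, det_updateRow_eq_sum_mul_adjugate, partialAdjugate, mul_apply,
    mixRows_of_notMem hk]

theorem exchangeStep_partialAdjugate [IsDomain R] (A : Matrix ι ι R) {s : Finset ι} {k : ι}
    (hk : k ∉ s) (hdet : (mixRows (insert k s) A 1).det ≠ 0) :
    exchangeStep (partialAdjugate A s) (mixRows s A 1).det k =
      (mixRows s A 1).det • partialAdjugate A (insert k s) := by
  have hone : (1 : Matrix ι ι R) k = Pi.single k 1 := by
    ext j; simp [one_apply, Pi.single_apply, eq_comm]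
  have hM : mixRows s A 1 k = Pi.single k 1 := by rw [mixRows_of_notMem hk, hone]
  have hmul := exchangeStep_mul_updateRow (N := mixRows s 1 A) hM
  rw [mixRows_of_notMem hk 1 A, ← hone, ← mixRows_insert, ← mixRows_insert] at hmul
  refine smul_right_injective _ hdet ?_
  calc (mixRows (insert k s) A 1).det • exchangeStep (partialAdjugate A s) (mixRows s A 1).det k
      = exchangeStep (partialAdjugate A s) (mixRows s A 1).det k * mixRows (insert k s) A 1 *
          (mixRows (insert k s) A 1).adjugate := by
        rw [Matrix.mul_assoc, mul_adjugate, Matrix.mul_smul, Matrix.mul_one]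
    _ = _ := by
        rw [partialAdjugate, hmul, Matrix.smul_mul, mul_comm, mul_smul]
        rfl

section Bounds

variable [LinearOrder R] [IsStrictOrderedRing R] {A : Matrix ι ι R} {x : R}

theorem abs_det_le (hA : ∀ i j, |A i j| ≤ x) :
    |A.det| ≤ (Fintype.card ι).factorial * x ^ Fintype.card ι := by
  simpa [nsmul_eq_mul] using det_le (abv := AbsoluteValue.abs) hA

theorem abs_adjugate_le (hx : 1 ≤ x) (hA : ∀ i j, |A i j| ≤ x) (i j : ι) :
    |A.adjugate i j| ≤ (Fintype.card ι).factorial * x ^ Fintype.card ι := by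
  rw [adjugate_apply]
  refine abs_det_le fun u v => ?_
  by_cases hu : u = j
  · subst hu
    rw [updateRow_self, Pi.single_apply]
    split_ifs <;> simp <;> linarith
  · rw [updateRow_ne hu]
    exact hA u v

theorem abs_partialAdjugate_le (hx : 1 ≤ x) (hA : ∀ i j, |A i j| ≤ x) (s : Finset ι) (i j : ι) :
    |partialAdjugate A s i j| ≤
      Fintype.card ι * (x * ((Fintype.card ι).factorial * x ^ Fintype.card ι)) := by
  have hone (i j : ι) : |(1 : Matrix ι ι R) i j| ≤ x := by
    rw [one_apply]; split_ifs <;> simp <;> linarith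
  rw [partialAdjugate, mul_apply, ← nsmul_eq_mul]
  refine (Finset.abs_sum_le_sum_abs _ _).trans (Finset.sum_le_card_nsmul _ _ _ fun l _ => ?_)
  rw [abs_mul]
  exact mul_le_mul (forall_mixRows (p := (|·| ≤ x)) hone hA s i l)
    (abs_adjugate_le hx (forall_mixRows (p := (|·| ≤ x)) hA hone s) l j) (abs_nonneg _)
    (zero_le_one.trans hx)

end Bounds

end MatrixInversion

/-! ## Green functions -/

theorem forall_of_preconnected {V : Type*} {G : SimpleGraph V} (hG : G.Preconnected)
    {p : V → Prop} (hp : ∀ ⦃u v⦄, G.Adj u v → p u → p v) {u : V} (hu : p u) (v : V) : p v := by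
  obtain ⟨walk⟩ := hG u v
  induction walk with
  | nil => exact hu
  | cons h _ ih => exact ih (hp h hu)

namespace Sandpile

section Laplace

variable {V : Type} [Fintype V] {S : Sandpile V}

variable (S) in
/-- The Laplacian acting on functions on the vertices, edges being counted with multiplicity. -/
def laplace : (V → ℝ) →ₗ[ℝ] V → ℝ :=
  .pi fun v => ∑ u, (S.mult v u : ℝ) • (.proj v - .proj u)

theorem laplace_apply (f : V → ℝ) (v : V) :
    S.laplace f v = ∑ u, (S.mult v u : ℝ) * (f v - f u) := by
  simp [laplace]

theorem laplace_eq_degree_mul_sub (f : V → ℝ) (v : V) :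
    S.laplace f v = S.degree v * f v - ∑ u, (S.mult v u : ℝ) * f u := by
  simp [laplace_apply, degree, mul_sub, Finset.sum_sub_distrib, Finset.sum_mul]

theorem nonneg_of_laplace_nonneg {f : V → ℝ} (hs : 0 ≤ f S.sink)
    (hf : ∀ v, v ≠ S.sink → f v < 0 → 0 ≤ S.laplace f v) (v : V) : 0 ≤ f v := by
  obtain ⟨x, -, hx⟩ := Finset.exists_min_image Finset.univ f ⟨v, Finset.mem_univ v⟩
  by_contra! hv
  have hneg : f x < 0 := (hx v (Finset.mem_univ v)).trans_lt hv
  have hstep : ∀ ⦃y z⦄, S.graph.Adj y z → f y = f x → f z = f x := by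
    intro y z hyz hy
    have hl := hf y (by rintro rfl; linarith) (by linarith)
    have hterm : ∀ u ∈ Finset.univ, (S.mult y u : ℝ) * (f y - f u) ≤ 0 := fun u hu =>
      mul_nonpos_of_nonneg_of_nonpos (Nat.cast_nonneg _) (by have := hx u hu; linarith)
    rw [laplace_apply] at hl
    have hzero := (Finset.sum_eq_zero_iff_of_nonpos hterm).1
      (le_antisymm (Finset.sum_nonpos hterm) hl) z (Finset.mem_univ z)
    have hpos : (0 : ℝ) < S.mult y z := Nat.cast_pos.2 hyz
    linarith [(mul_eq_zero.1 hzero).resolve_left hpos.ne']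
  linarith [forall_of_preconnected S.connected.preconnected hstep rfl S.sink]

theorem eq_zero_of_laplace_eq_zero {f : V → ℝ} (hs : f S.sink = 0)
    (hf : ∀ v, v ≠ S.sink → f v ≠ 0 → S.laplace f v = 0) : f = 0 := by
  refine funext fun v => le_antisymm ?_ ?_
  · refine neg_nonneg.1
      (nonneg_of_laplace_nonneg (S := S) (f := -f) (by simp [hs]) (fun v hv h => ?_) v)
    have hfv : f v ≠ 0 := fun h0 => by simp [h0] at h
    simp [hf v hv hfv]
  · exact nonneg_of_laplace_nonneg hs.ge (fun v hv h => (hf v hv h.ne).ge) v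

theorem mult_le_degree (u v : V) : S.mult u v ≤ S.degree u :=
  Finset.single_le_sum (f := S.mult u) (fun _ _ => Nat.zero_le _) (Finset.mem_univ v)

theorem degree_pos {v : V} (hv : v ≠ S.sink) : 0 < S.degree v := by
  have : Nontrivial V := ⟨v, S.sink, hv⟩
  obtain ⟨u, hu⟩ := S.connected.preconnected.exists_adj_of_nontrivial v
  exact lt_of_lt_of_le hu (mult_le_degree v u)

theorem isPotential_iff {w : S.Ordinary} {f : V → ℝ} :
    S.IsPotential w f ↔ f S.sink = 0 ∧ f w = 1 ∧
      ∀ v, v ≠ S.sink → v ≠ w → S.laplace f v = 0 := by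
  refine and_congr_right' (and_congr_right' (forall₃_congr fun v hv _ => ?_))
  have hd : (S.degree v : ℝ) ≠ 0 := Nat.cast_ne_zero.2 (degree_pos hv).ne'
  rw [div_eq_iff hd, laplace_eq_degree_mul_sub, sub_eq_zero, mul_comm (f v), eq_comm]

theorem IsPotential.unique {w : S.Ordinary} {f g : V → ℝ} (hf : S.IsPotential w f)
    (hg : S.IsPotential w g) : f = g := by
  rw [isPotential_iff] at hf hg
  refine sub_eq_zero.1 (eq_zero_of_laplace_eq_zero (S := S) (by simp [hf.1, hg.1])
    fun v hv hne => ?_)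
  have hvw : v ≠ w := by rintro rfl; simp [hf.2.1, hg.2.1] at hne
  simp [hf.2.2 v hv hvw, hg.2.2 v hv hvw]

end Laplace

section Green

variable {V : Type} [Fintype V] [DecidableEq V] {S : Sandpile V}

variable (S) in
/-- The Laplacian matrix, with the row and the column of the sink replaced by those of the
identity, which makes it invertible. -/
def reducedLaplacian : Matrix V V ℤ := fun i j =>
  if i = S.sink ∨ j = S.sink then if i = j then 1 else 0
  else if i = j then S.degree i else -S.mult i j

theorem reducedLaplacian_transpose : S.reducedLaplacian.transpose = S.reducedLaplacian := by
  ext i j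
  simp only [Matrix.transpose_apply, reducedLaplacian, or_comm, eq_comm (a := j), S.mult_comm j i]
  split_ifs with h1 h2 h3 <;> simp_all

theorem reducedLaplacian_sink : S.reducedLaplacian S.sink = Pi.single S.sink 1 := by
  ext j
  simp [reducedLaplacian, Pi.single_apply, eq_comm]

theorem sum_reducedLaplacian_mul {f : V → ℝ} (hf : f S.sink = 0) {v : V} (hv : v ≠ S.sink) :
    ∑ u, (S.reducedLaplacian v u : ℝ) * f u = S.laplace f v := by
  have hterm (u : V) : (S.reducedLaplacian v u : ℝ) * f u =
      (if u = v then (S.degree v : ℝ) * f v else 0) - S.mult v u * f u := by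
    by_cases hu : u = S.sink
    · subst hu; simp [hf, Ne.symm hv]
    · by_cases huv : u = v
      · subst huv; simp [reducedLaplacian, hu, S.mult_self]
      · simp [reducedLaplacian, hu, hv, huv, Ne.symm huv]
  simp [hterm, Finset.sum_sub_distrib, laplace_eq_degree_mul_sub]

theorem det_mixRows_reducedLaplacian_ne_zero (s : Finset V) :
    (mixRows s S.reducedLaplacian 1).det ≠ 0 := by
  intro hdet
  have hdet' : ((Int.castRingHom ℝ).mapMatrix (mixRows s S.reducedLaplacian 1)).det = 0 := by
    rw [← RingHom.map_det, hdet, map_zero]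
  obtain ⟨x, hx, hMx⟩ := Matrix.exists_mulVec_eq_zero_iff.2 hdet'
  have hrow (i : V) : ∑ j, ((mixRows s S.reducedLaplacian 1 i j : ℤ) : ℝ) * x j = 0 :=
    congrFun hMx i
  have hs : x S.sink = 0 := by
    have hsink := hrow S.sink
    by_cases h : S.sink ∈ s
    · simpa [mixRows_of_mem h, reducedLaplacian_sink, Pi.single_apply] using hsink
    · simpa [mixRows_of_notMem h, Matrix.one_apply] using hsink
  refine hx (eq_zero_of_laplace_eq_zero hs fun v hv hxv => ?_)
  have hv' := hrow v
  by_cases h : v ∈ s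
  · rwa [mixRows_of_mem h, sum_reducedLaplacian_mul hs hv] at hv'
  · exact absurd (by simpa [mixRows_of_notMem h, Matrix.one_apply] using hv') hxv

theorem det_reducedLaplacian_ne_zero : S.reducedLaplacian.det ≠ 0 := by
  simpa [mixRows_univ] using det_mixRows_reducedLaplacian_ne_zero (S := S) Finset.univ

variable (S) in
/-- The Green function with pole `w`: its Laplacian at the ordinary vertices is the indicator
of `w`, and it vanishes at the sink. -/
noncomputable def green (w v : V) : ℝ :=
  S.reducedLaplacian.adjugate v w / S.reducedLaplacian.det

theorem sum_reducedLaplacian_mul_green (v w : V) :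
    ∑ u, (S.reducedLaplacian v u : ℝ) * S.green w u = if v = w then 1 else 0 := by
  have hdet : (S.reducedLaplacian.det : ℝ) ≠ 0 := Int.cast_ne_zero.2 det_reducedLaplacian_ne_zero
  have hmul : ∑ u, S.reducedLaplacian v u * S.reducedLaplacian.adjugate u w =
      if v = w then S.reducedLaplacian.det else 0 := by
    rw [← Matrix.mul_apply, Matrix.mul_adjugate]
    simp [Matrix.one_apply]
  have hmul' : ∑ u, (S.reducedLaplacian v u : ℝ) * S.reducedLaplacian.adjugate u w =
      if v = w then (S.reducedLaplacian.det : ℝ) else 0 := mod_cast hmul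
  simp only [green, mul_div_assoc', ← Finset.sum_div, hmul']
  split_ifs <;> simp [hdet]

theorem green_comm (v w : V) : S.green v w = S.green w v := by
  have h := congrFun₂ (Matrix.adjugate_transpose S.reducedLaplacian) v w
  rw [reducedLaplacian_transpose, Matrix.transpose_apply] at h
  rw [green, green, h]

theorem green_sink {w : V} (hw : w ≠ S.sink) : S.green w S.sink = 0 := by
  simpa [reducedLaplacian_sink, Pi.single_apply, hw.symm] using
    sum_reducedLaplacian_mul_green (S := S) S.sink w

theorem laplace_green {v w : V} (hw : w ≠ S.sink) (hv : v ≠ S.sink) :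
    S.laplace (S.green w) v = if v = w then 1 else 0 := by
  rw [← sum_reducedLaplacian_mul (green_sink hw) hv, sum_reducedLaplacian_mul_green]

theorem laplace_green_nonneg {v w : V} (hw : w ≠ S.sink) (hv : v ≠ S.sink) :
    0 ≤ S.laplace (S.green w) v := by
  rw [laplace_green hw hv]; split_ifs <;> norm_num

theorem green_nonneg {w : V} (hw : w ≠ S.sink) (v : V) : 0 ≤ S.green w v :=
  nonneg_of_laplace_nonneg (green_sink hw).ge (fun _ hv _ => laplace_green_nonneg hw hv) v

theorem green_pos (hS : S.ConnectedOffSink) (w v : S.Ordinary) : 0 < S.green w v := by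
  have hterm (x u : V) : 0 ≤ (S.mult x u : ℝ) * S.green w u :=
    mul_nonneg (Nat.cast_nonneg _) (green_nonneg w.2 u)
  have hstep : ∀ ⦃x y : S.Ordinary⦄, S.graph.Adj x y → S.green w x = 0 → S.green w y = 0 := by
    intro x y hxy hx
    have hl := laplace_green_nonneg w.2 x.2
    rw [laplace_eq_degree_mul_sub, hx, mul_zero, zero_sub, neg_nonneg] at hl
    have hzero := (Finset.sum_eq_zero_iff_of_nonneg fun u _ => hterm x u).1
      (hl.antisymm (Finset.sum_nonneg fun u _ => hterm x u)) y (Finset.mem_univ _)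
    have hpos : (0 : ℝ) < S.mult x y := Nat.cast_pos.2 hxy
    exact (mul_eq_zero.1 hzero).resolve_left hpos.ne'
  refine (green_nonneg w.2 v).lt_of_ne' fun hv => ?_
  have hw : S.green w w = 0 := forall_of_preconnected hS hstep hv w
  have hl := laplace_green (v := (w : V)) w.2 w.2
  rw [laplace_eq_degree_mul_sub, hw, if_pos rfl] at hl
  linarith [Finset.sum_nonneg fun u (_ : u ∈ Finset.univ) => hterm w u]

theorem isPotential_green (hS : S.ConnectedOffSink) (w : S.Ordinary) :
    S.IsPotential w ((S.green w w)⁻¹ • S.green w) := by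
  refine isPotential_iff.2 ⟨by simp [green_sink w.2], by simp [(green_pos hS w w).ne'],
    fun v hv hvw => ?_⟩
  simp [laplace_green w.2 hv, hvw]

theorem potentialEstimates_eq (hS : S.ConnectedOffSink) :
    S.potentialEstimates =
      {r | ∃ v w : S.Ordinary, r = (∑ u : S.Ordinary, S.green w u) / S.green w v} := by
  have hratio (v w : S.Ordinary) : 1 / ((S.green w w)⁻¹ • S.green w) v *
      ∑ u : S.Ordinary, ((S.green w w)⁻¹ • S.green w) u =
        (∑ u : S.Ordinary, S.green w u) / S.green w v := by
    have hw := (green_pos hS w w).ne'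
    simp only [Pi.smul_apply, smul_eq_mul, ← Finset.mul_sum]
    field_simp
  ext r
  constructor
  · rintro ⟨v, w, f, hf, rfl⟩
    exact ⟨v, w, by rw [hf.unique (isPotential_green hS w), hratio]⟩
  · rintro ⟨v, w, rfl⟩
    exact ⟨v, w, _, isPotential_green hS w, (hratio v w).symm⟩

end Green

end Sandpile

/-! ## Recurrence and forbidden subconfigurations -/

namespace Sandpile

section Forbidden

variable {V : Type} {S : Sandpile V}

variable (S) in
/-- No subconfiguration of `c` supported in `T` is forbidden: every nonempty set `F` of vertices
in `T` has a vertex with at least as many particles as edges into `F`. -/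
def NoForbiddenOn (T : Set S.Ordinary) (c : S.Config) : Prop :=
  ∀ F : Finset S.Ordinary, F.Nonempty → ↑F ⊆ T → ∃ v ∈ F, ∑ u ∈ F, S.mult v u ≤ c v

theorem noForbiddenOn_empty (c : S.Config) : S.NoForbiddenOn ∅ c := fun _ ⟨_, hv⟩ hFT =>
  (hFT hv).elim

theorem NoForbiddenOn.mono {T : Set S.Ordinary} {c c' : S.Config} (hc : S.NoForbiddenOn T c)
    (h : c ≤ c') : S.NoForbiddenOn T c' := fun F hF hFT =>
  let ⟨v, hv, hle⟩ := hc F hF hFT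
  ⟨v, hv, hle.trans (h v)⟩

variable [Fintype V]

theorem sum_ordinary_mult_le_degree (v : V) (F : Finset S.Ordinary) :
    ∑ u ∈ F, S.mult v u ≤ S.degree v := by
  classical
  rw [degree, Fintype.sum_eq_add_sum_subtype_ne (S.mult v) S.sink]
  exact (Finset.sum_le_sum_of_subset (Finset.subset_univ F)).trans (Nat.le_add_left _ _)

variable [DecidableEq V]

theorem NoForbiddenOn.topple {T : Set S.Ordinary} {c : S.Config} (hc : S.NoForbiddenOn T c)
    (y : S.Ordinary) : S.NoForbiddenOn (insert y T) (S.topple y c) := by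
  intro F hF hFT
  rcases (F.erase y).eq_empty_or_nonempty with hempty | hne
  · obtain rfl : F = {y} := ((Finset.erase_eq_empty_iff F y).1 hempty).resolve_left hF.ne_empty
    exact ⟨y, by simp, by simp [S.mult_self]⟩
  · have hsub : ↑(F.erase y) ⊆ T := by
      rwa [Finset.coe_erase, Set.sdiff_singleton_subset_iff]
    obtain ⟨v, hv, hle⟩ := hc _ hne hsub
    obtain ⟨hvy, hvF⟩ := Finset.mem_erase.1 hv
    refine ⟨v, hvF, ?_⟩
    calc ∑ u ∈ F, S.mult v u ≤ ∑ u ∈ insert y (F.erase y), S.mult v u :=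
          Finset.sum_le_sum_of_subset (Finset.insert_erase_subset y F)
      _ = S.mult v y + ∑ u ∈ F.erase y, S.mult v u := Finset.sum_insert (Finset.notMem_erase y F)
      _ ≤ S.topple y c v := by
          rw [Sandpile.topple, if_neg hvy, S.mult_comm v y, add_comm]; gcongr

theorem NoForbiddenOn.relaxes {c c' : S.Config} (hc : S.NoForbiddenOn .univ c)
    (h : S.Relaxes c c') : S.NoForbiddenOn .univ c' := by
  induction h with
  | refl => exact hc
  | tail _ h ih =>
    obtain ⟨y, -, rfl⟩ := h
    simpa using ih.topple y

theorem Recurrent.noForbiddenOn {c : S.Config} (hc : S.Recurrent c) :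
    S.NoForbiddenOn .univ c := by
  obtain ⟨d, hd, hr⟩ := hc fun v => S.degree v
  have hdeg : S.NoForbiddenOn .univ fun v : S.Ordinary => S.degree v := fun F ⟨v, hv⟩ _ =>
    ⟨v, hv, sum_ordinary_mult_le_degree (v : V) F⟩
  exact (hdeg.mono hd).relaxes hr

end Forbidden

section Burning

variable {V : Type} [Fintype V] {S : Sandpile V}

variable (S) in
/-- Firing every vertex `v` exactly `r v` times, legally or not, leads from `e` to `c`; the
balance of particles is arranged so as to avoid subtraction. -/
structure IsFiring (r : V → ℕ) (e c : S.Config) : Prop where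
  sink : r S.sink = 0
  balance (v : S.Ordinary) : e v + ∑ u, S.mult v u * r u = c v + S.degree v * r v

/- Dhar's burning argument: the vertices fired most often contain one that, having enough
particles in the end, can start. -/
theorem IsFiring.exists_degree_le {r : V → ℕ} {e c : S.Config} (h : S.IsFiring r e c)
    (hc : S.NoForbiddenOn .univ c) (hr : r ≠ 0) :
    ∃ v : S.Ordinary, 0 < r v ∧ S.degree v ≤ e v := by
  classical
  obtain ⟨x, -, hx⟩ := Finset.exists_max_image Finset.univ r ⟨S.sink, Finset.mem_univ _⟩
  have hmax (u : V) : r u ≤ r x := hx u (Finset.mem_univ u)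
  have hpos : 0 < r x := Nat.pos_of_ne_zero fun h0 =>
    hr (funext fun u => Nat.le_zero.1 ((hmax u).trans h0.le))
  have hxs : x ≠ S.sink := by rintro rfl; exact hpos.ne' h.sink
  obtain ⟨v, hv, hle⟩ := hc (Finset.univ.filter fun u : S.Ordinary => r u = r x)
    ⟨⟨x, hxs⟩, by simp⟩ (Set.subset_univ _)
  have hvx : r v = r x := (Finset.mem_filter.1 hv).2
  refine ⟨v, hvx ▸ hpos, ?_⟩
  have hfired : ∑ u, (if r u = r x then S.mult v u else 0) ≤ c v := by
    rw [Fintype.sum_eq_add_sum_subtype_ne _ S.sink, if_neg (by simp [h.sink, hpos.ne]), zero_add,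
      ← Finset.sum_filter]
    exact hle
  have hterm (u : V) : S.mult v u * r u + S.mult v u ≤
      S.mult v u * r x + if r u = r x then S.mult v u else 0 := by
    split_ifs with hu
    · rw [hu]
    · rw [← Nat.mul_succ, add_zero]
      exact Nat.mul_le_mul_left _ (lt_of_le_of_ne (hmax u) hu)
  have hsum := Finset.sum_le_sum fun u (_ : u ∈ Finset.univ) => hterm u
  rw [Finset.sum_add_distrib, Finset.sum_add_distrib, ← Finset.sum_mul] at hsum
  have hbal := h.balance v
  rw [hvx] at hbal
  simp only [degree] at hbal ⊢
  omega

theorem exists_nat_one_le_laplace (S : Sandpile V) :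
    ∃ f : V → ℕ, f S.sink = 0 ∧ ∀ v, v ≠ S.sink → 1 ≤ S.laplace (fun u => f u) v := by
  classical
  have hdet := det_reducedLaplacian_ne_zero (S := S)
  let f (u : V) : ℕ := ∑ w : S.Ordinary, (S.reducedLaplacian.adjugate u w).natAbs
  have hgreen : (fun u => (f u : ℝ)) =
      |(S.reducedLaplacian.det : ℝ)| • ∑ w : S.Ordinary, S.green w := by
    funext u
    simp only [f, Nat.cast_sum, Pi.smul_apply, Finset.sum_apply, smul_eq_mul, Finset.mul_sum]
    refine Finset.sum_congr rfl fun w _ => ?_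
    rw [← abs_of_nonneg (green_nonneg w.2 u), ← abs_mul, green,
      mul_div_cancel₀ _ (Int.cast_ne_zero.2 hdet), Nat.cast_natAbs, Int.cast_abs]
  refine ⟨f, ?_, fun v hv => ?_⟩
  · have hsink := congrFun hgreen S.sink
    have hzero (w : S.Ordinary) : S.green w S.sink = 0 := green_sink w.2
    simpa [hzero] using hsink
  · have hsum : ∑ w : S.Ordinary, S.laplace (S.green w) v = 1 := by
      rw [Finset.sum_congr rfl fun w _ => laplace_green w.2 hv,
        Finset.sum_eq_single ⟨v, hv⟩ (fun w _ hw => if_neg fun h => hw (Subtype.ext h.symm))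
          (by simp), if_pos rfl]
    rw [hgreen, map_smul, map_sum, Pi.smul_apply, Finset.sum_apply, hsum, smul_eq_mul, mul_one]
    exact_mod_cast Int.one_le_abs hdet

variable [DecidableEq V]

theorem IsFiring.topple {r : V → ℕ} {e c : S.Config} {v : S.Ordinary}
    (h : S.IsFiring (Pi.single (v : V) 1 + r) e c) (hv : S.degree v ≤ e v) :
    S.IsFiring r (S.topple v e) c where
  sink := by simpa [Pi.single_apply, v.2.symm] using h.sink
  balance u := by
    have hu := h.balance u
    simp only [Pi.add_apply, mul_add, Finset.sum_add_distrib, Pi.single_apply, mul_ite, mul_one,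
      mul_zero, Finset.sum_ite_eq', Finset.mem_univ, if_true] at hu
    by_cases huv : u = v
    · subst huv
      rw [S.mult_self, if_pos rfl] at hu
      rw [Sandpile.topple, if_pos rfl]
      omega
    · rw [if_neg (Subtype.coe_ne_coe.2 huv)] at hu
      rw [Sandpile.topple, if_neg huv, S.mult_comm v u]
      omega

theorem IsFiring.relaxes {r : V → ℕ} {e c : S.Config} (h : S.IsFiring r e c)
    (hc : S.NoForbiddenOn .univ c) : S.Relaxes e c := by
  induction hk : ∑ u, r u generalizing r e with
  | zero =>
    have hr : r = 0 := funext fun u => Finset.sum_eq_zero_iff.1 hk u (Finset.mem_univ u)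
    obtain rfl : e = c := funext fun v => by simpa [hr] using h.balance v
    exact .refl
  | succ k ih =>
    have hr : r ≠ 0 := by rintro rfl; simp at hk
    obtain ⟨v, hv, hle⟩ := h.exists_degree_le hc hr
    have hsingle : Pi.single (v : V) 1 ≤ r := update_le_iff.2 ⟨hv, fun _ _ => Nat.zero_le _⟩
    obtain ⟨r', rfl⟩ := le_iff_exists_add.1 hsingle
    refine .head ⟨v, hle, rfl⟩ (ih (h.topple hle) ?_)
    simp only [Pi.add_apply, Finset.sum_add_distrib, Finset.sum_pi_single', Finset.mem_univ,
      if_true] at hk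
    omega

theorem NoForbiddenOn.recurrent {c : S.Config} (hc : S.NoForbiddenOn .univ c) :
    S.Recurrent c := by
  intro c'
  obtain ⟨f, hf0, hf⟩ := exists_nat_one_le_laplace S
  have hle (v : S.Ordinary) : 1 + ∑ u, S.mult v u * f u ≤ S.degree v * f v := by
    have hv := hf v v.2
    rw [laplace_eq_degree_mul_sub, le_sub_iff_add_le] at hv
    exact_mod_cast hv
  choose g hg using fun v => Nat.exists_eq_add_of_le (hle v)
  set N := ∑ w, c' w
  refine ⟨fun v => c v + N * (1 + g v), fun v => ?_,
    IsFiring.relaxes (r := fun v => N * f v) ⟨by simp [hf0], fun v => ?_⟩ hc⟩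
  · have hN : c' v ≤ N := Finset.single_le_sum (fun _ _ => Nat.zero_le _) (Finset.mem_univ v)
    exact (hN.trans (Nat.le_mul_of_pos_right N (by omega))).trans (Nat.le_add_left _ _)
  · simp only [mul_left_comm _ N, ← Finset.mul_sum, hg]
    ring

end Burning

/-! ## Weights and the upper bound -/

section Weight

variable {V : Type} [Fintype V] [DecidableEq V] {S : Sandpile V}

/-- The total weight of a configuration whose particles at `u` weigh `h u` each. -/
def weight (h : V → ℝ) (c : S.Config) : ℝ := ∑ u : S.Ordinary, h u * c u

theorem weight_zero (h : V → ℝ) : weight h (0 : S.Config) = 0 := by simp [weight]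

theorem weight_add (h : V → ℝ) (c d : S.Config) : weight h (c + d) = weight h c + weight h d := by
  simp [weight, mul_add, Finset.sum_add_distrib]

theorem weight_single (h : V → ℝ) (v : S.Ordinary) :
    weight h (Pi.single v 1 : S.Config) = h v := by
  simp [weight, Pi.single_apply]

theorem weight_topple {h : V → ℝ} (hs : h S.sink = 0) {v : S.Ordinary} {c : S.Config}
    (hv : S.degree v ≤ c v) : weight h (S.topple v c) = weight h c - S.laplace h v := by
  have hterm (u : S.Ordinary) : h u * (S.topple v c u : ℝ) =
      h u * c u + S.mult v u * h u - if u = v then S.degree v * h v else 0 := by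
    by_cases huv : u = v
    · subst huv
      rw [topple, if_pos rfl, if_pos rfl, S.mult_self, Nat.cast_sub hv]
      push_cast; ring
    · rw [topple, if_neg huv, if_neg huv]
      push_cast; ring
  simp only [weight, hterm, Finset.sum_sub_distrib, Finset.sum_add_distrib,
    laplace_eq_degree_mul_sub,
    Fintype.sum_eq_add_sum_subtype_ne (fun u => (S.mult v u : ℝ) * h u) S.sink, hs,
    Finset.sum_ite_eq', Finset.mem_univ, if_true]
  ring

theorem Relaxes.weight_le {h : V → ℝ} (hs : h S.sink = 0)
    (hl : ∀ v, v ≠ S.sink → 0 ≤ S.laplace h v) {c c' : S.Config} (hr : S.Relaxes c c') :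
    weight h c' ≤ weight h c := by
  induction hr with
  | refl => exact le_rfl
  | tail _ ht ih =>
    obtain ⟨v, hv, rfl⟩ := ht
    rw [weight_topple hs hv]
    linarith [hl v v.2]

theorem Relaxes.sum_le {c c' : S.Config} (hr : S.Relaxes c c') : ∑ u, c' u ≤ ∑ u, c u := by
  let h (u : V) : ℝ := if u = S.sink then 0 else 1
  have hweight (c : S.Config) : weight h c = (∑ u, c u : ℕ) := by
    simp only [weight, h, Nat.cast_sum]
    exact Finset.sum_congr rfl fun u _ => by rw [if_neg u.2, one_mul]
  have hle : weight h c' ≤ weight h c := hr.weight_le (by simp [h]) fun v hv => by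
    rw [laplace_apply]
    refine Finset.sum_nonneg fun u _ => mul_nonneg (Nat.cast_nonneg _) ?_
    simp only [h, if_neg hv]
    split_ifs <;> norm_num
  rw [hweight, hweight] at hle
  exact_mod_cast hle

theorem exists_relaxes_stable (c : S.Config) : ∃ c', S.Relaxes c c' ∧ S.Stable c' := by
  obtain ⟨f, hf0, hf⟩ := exists_nat_one_le_laplace S
  induction hk : ∑ u : S.Ordinary, f u * c u using Nat.strong_induction_on generalizing c with
  | _ k ih =>
    by_cases hst : S.Stable c
    · exact ⟨c, .refl, hst⟩
    · simp only [Stable, not_forall, not_lt] at hst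
      obtain ⟨v, hv⟩ := hst
      have hdrop : weight (fun u => (f u : ℝ)) (S.topple v c) < weight (fun u => (f u : ℝ)) c := by
        rw [weight_topple (by simp [hf0]) hv]
        linarith [hf v v.2]
      have hlt : ∑ u : S.Ordinary, f u * S.topple v c u < k := by
        simp only [weight] at hdrop
        rw [← hk]
        exact_mod_cast hdrop
      obtain ⟨c', hr, hs⟩ := ih _ hlt _ rfl
      exact ⟨c', .head ⟨v, hv, rfl⟩ hr, hs⟩

end Weight

section Upper

variable {V : Type} [Fintype V] [DecidableEq V] {S : Sandpile V}

variable (S) in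
/-- The state of a run in which the particles `a` have been added, `T` is the set of the vertices
that have toppled, and `c` is the current configuration: the Green functions with poles off `T`
have been harmonic at each toppling. -/
structure Tracks (a : S.Config) (T : Set S.Ordinary) (c : S.Config) : Prop where
  noForbiddenOn : S.NoForbiddenOn T c
  weight_eq : ∀ v ∉ T, weight (S.green v) c = weight (S.green v) a

theorem Tracks.zero : S.Tracks 0 ∅ 0 where
  noForbiddenOn := noForbiddenOn_empty 0
  weight_eq _ _ := rfl

theorem Tracks.add {a c : S.Config} {T : Set S.Ordinary} (h : S.Tracks a T c)
    (d : S.Config) : S.Tracks (a + d) T (c + d) where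
  noForbiddenOn := h.noForbiddenOn.mono le_self_add
  weight_eq v hv := by rw [weight_add, weight_add, h.weight_eq v hv]

theorem Tracks.topple {a c : S.Config} {T : Set S.Ordinary} (h : S.Tracks a T c)
    {y : S.Ordinary} (hy : S.degree y ≤ c y) : S.Tracks a (insert y T) (S.topple y c) where
  noForbiddenOn := h.noForbiddenOn.topple y
  weight_eq v hv := by
    rw [Set.mem_insert_iff, not_or] at hv
    rw [weight_topple (green_sink v.2) hy, laplace_green v.2 y.2,
      if_neg fun hyv => hv.1 (Subtype.ext hyv.symm), sub_zero, h.weight_eq v hv.2]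

theorem Tracks.relaxes {a c c' : S.Config} {T : Set S.Ordinary} (h : S.Tracks a T c)
    (hr : S.Relaxes c c') : ∃ T', S.Tracks a T' c' := by
  induction hr with
  | refl => exact ⟨T, h⟩
  | tail _ ht ih =>
    obtain ⟨T', h'⟩ := ih
    obtain ⟨v, hv, rfl⟩ := ht
    exact ⟨_, h'.topple hv⟩

theorem TransientRun.exists_tracks {k : ℕ} {c : S.Config} (h : S.TransientRun k c) :
    ∃ a T, ∑ u, a u = k ∧ S.Tracks a T c := by
  induction h with
  | empty => exact ⟨0, ∅, by simp, .zero⟩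
  | add v _ hr _ _ ih =>
    obtain ⟨a, T, hsum, ha⟩ := ih
    obtain ⟨T', hT'⟩ := (ha.add (Pi.single v 1)).relaxes hr
    exact ⟨_, T', by simp [Finset.sum_add_distrib, hsum], hT'⟩

theorem TransientRun.not_recurrent {k : ℕ} {c : S.Config} (h : S.TransientRun k c) :
    ¬ S.Recurrent c := by
  cases h <;> assumption

theorem TransientRun.stable {k : ℕ} {c : S.Config} (h : S.TransientRun k c) : S.Stable c := by
  cases h with
  | empty => exact fun v => degree_pos v.2
  | add => assumption

/- If all the vertices had toppled, there would be no forbidden subconfiguration and `c` would be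
recurrent. -/
theorem TransientRun.exists_weight_eq {k : ℕ} {c : S.Config} (h : S.TransientRun k c) :
    ∃ (a : S.Config) (v : S.Ordinary), ∑ u, a u = k ∧
      weight (S.green v) c = weight (S.green v) a := by
  obtain ⟨a, T, hsum, hT⟩ := h.exists_tracks
  obtain ⟨v, hv⟩ : ∃ v, v ∉ T := by
    by_contra! hall
    rw [← Set.eq_univ_iff_forall] at hall
    subst hall
    exact h.not_recurrent hT.noForbiddenOn.recurrent
  exact ⟨a, v, hsum, hT.weight_eq v hv⟩

theorem TransientRun.le_mul (hS : S.ConnectedOffSink) {Δ : ℕ}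
    (hΔ : ∀ v : S.Ordinary, S.degree v ≤ Δ) {A : ℝ} (hA : A ∈ upperBounds S.potentialEstimates)
    {k : ℕ} {c : S.Config} (h : S.TransientRun k c) : (k : ℝ) ≤ Δ * A := by
  obtain ⟨a, v, rfl, heq⟩ := h.exists_weight_eq
  have hratio (w : S.Ordinary) : ∑ u : S.Ordinary, S.green v u ≤ A * S.green v w := by
    rw [← div_le_iff₀ (green_pos hS v w)]
    exact hA (potentialEstimates_eq hS ▸ ⟨w, v, rfl⟩)
  have hsum : 0 < ∑ u : S.Ordinary, S.green v u :=
    Finset.sum_pos (fun u _ => green_pos hS v u) ⟨v, Finset.mem_univ v⟩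
  have hA0 : 0 ≤ A := (pos_of_mul_pos_left (hsum.trans_le (hratio v)) (green_pos hS v v).le).le
  have hadded : ((∑ u, a u : ℕ) : ℝ) * ∑ u : S.Ordinary, S.green v u ≤
      A * weight (S.green v) a := by
    rw [Nat.cast_sum, Finset.sum_mul, weight, Finset.mul_sum]
    refine Finset.sum_le_sum fun w _ => ?_
    rw [mul_comm, ← mul_assoc]
    exact mul_le_mul_of_nonneg_right (hratio w) (Nat.cast_nonneg _)
  have hstable : weight (S.green v) c ≤ Δ * ∑ u : S.Ordinary, S.green v u := by
    rw [weight, Finset.mul_sum]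
    refine Finset.sum_le_sum fun u _ => ?_
    rw [mul_comm]
    exact mul_le_mul_of_nonneg_right (mod_cast (h.stable u).le.trans (hΔ u))
      (green_pos hS v u).le
  refine le_of_mul_le_mul_right ?_ hsum
  rw [← heq] at hadded
  calc _ ≤ A * weight (S.green v) c := hadded
    _ ≤ A * (Δ * ∑ u : S.Ordinary, S.green v u) := mul_le_mul_of_nonneg_left hstable hA0
    _ = Δ * A * ∑ u : S.Ordinary, S.green v u := by ring

theorem TransientRun.eq_zero_of_zero (hS : S.ConnectedOffSink) {k : ℕ}
    (h : S.TransientRun k 0) : k = 0 := by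
  obtain ⟨a, v, rfl, heq⟩ := h.exists_weight_eq
  rw [weight_zero, weight, eq_comm, Finset.sum_eq_zero_iff_of_nonneg fun u _ =>
    mul_nonneg (green_pos hS v u).le (Nat.cast_nonneg _)] at heq
  refine Finset.sum_eq_zero fun u hu => ?_
  simpa [(green_pos hS v u).ne'] using heq u hu

end Upper

end Sandpile

/-! ## The lower bound and the transience class -/

namespace Sandpile

section OrdinaryTotal

variable {V : Type} {S : Sandpile V}

theorem NoForbiddenOn.sum_mult_le {c : S.Config} (hc : S.NoForbiddenOn .univ c)
    (F : Finset S.Ordinary) : ∑ u ∈ F, ∑ v ∈ F, S.mult u v ≤ 2 * ∑ u ∈ F, c u := by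
  classical
  induction hk : F.card generalizing F with
  | zero => simp [Finset.card_eq_zero.1 hk]
  | succ k ih =>
    obtain ⟨v, hv, hle⟩ := hc F (Finset.card_pos.1 (by omega)) (Set.subset_univ _)
    have herase := ih (F.erase v) (by rw [Finset.card_erase_of_mem hv]; omega)
    have hsplit (f : S.Ordinary → ℕ) : ∑ u ∈ F, f u = f v + ∑ u ∈ F.erase v, f u :=
      (Finset.add_sum_erase _ _ hv).symm
    have hrow : ∑ u ∈ F, S.mult v u = ∑ u ∈ F.erase v, S.mult v u := by
      rw [hsplit, S.mult_self, zero_add]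
    have hrows : ∑ u ∈ F.erase v, ∑ w ∈ F, S.mult u w =
        ∑ u ∈ F.erase v, S.mult v u + ∑ u ∈ F.erase v, ∑ w ∈ F.erase v, S.mult u w := by
      rw [← Finset.sum_add_distrib]
      exact Finset.sum_congr rfl fun u _ => by rw [hsplit, S.mult_comm]
    rw [hsplit fun u => ∑ w ∈ F, S.mult u w, hrows, hsplit c]
    omega

theorem NoForbiddenOn.pos_or_pos {c : S.Config} (hc : S.NoForbiddenOn .univ c)
    {u v : S.Ordinary} (huv : 0 < S.mult u v) : 0 < c u ∨ 0 < c v := by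
  classical
  have hne : u ≠ v := by rintro rfl; exact huv.ne' (S.mult_self u)
  obtain ⟨x, hx, hle⟩ := hc {u, v} (by simp) (Set.subset_univ _)
  rw [Finset.sum_pair hne] at hle
  rcases Finset.mem_insert.1 hx with rfl | hx
  · exact .inl (by omega)
  · obtain rfl := Finset.mem_singleton.1 hx
    rw [S.mult_comm x u] at hle
    exact .inr (by omega)

theorem ConnectedOffSink.exists_mult_pos (hS : S.ConnectedOffSink) {u v : S.Ordinary}
    (huv : u ≠ v) : ∃ w : S.Ordinary, 0 < S.mult u w :=
  have : Nontrivial {v | v ≠ S.sink} := ⟨u, v, huv⟩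
  SimpleGraph.Preconnected.exists_adj_of_nontrivial hS u

variable [Fintype V] [DecidableEq V]

variable (S) in
/-- Twice the number of edges between ordinary vertices. If deleting the sink leaves a connected
graph, the transience class is positive exactly when this exceeds `2`. -/
def ordinaryTotal : ℕ := ∑ u : S.Ordinary, ∑ v : S.Ordinary, S.mult u v

theorem nonempty_of_ordinaryTotal_pos (ht : 0 < S.ordinaryTotal) : Nonempty S.Ordinary := by
  by_contra hempty
  rw [not_nonempty_iff] at hempty
  simp [ordinaryTotal] at ht

theorem ConnectedOffSink.exists_mult_pos_of_ordinaryTotal_pos (hS : S.ConnectedOffSink)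
    (ht : 0 < S.ordinaryTotal) (u : S.Ordinary) : ∃ v : S.Ordinary, 0 < S.mult u v := by
  by_contra! hu
  have hall (v : S.Ordinary) : v = u := by
    by_contra hvu
    obtain ⟨w, hw⟩ := hS.exists_mult_pos (Ne.symm hvu)
    exact (hu w).not_gt hw
  refine ht.ne' (Finset.sum_eq_zero fun x _ => Finset.sum_eq_zero fun y _ => ?_)
  rw [hall x, hall y, S.mult_self]

theorem ConnectedOffSink.noForbiddenOn_of_ordinaryTotal_le (hS : S.ConnectedOffSink)
    (ht : S.ordinaryTotal ≤ 2) {c : S.Config} (hc : c ≠ 0) : S.NoForbiddenOn .univ c := by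
  rintro F ⟨x, hx⟩ -
  by_contra! hF
  obtain ⟨y, hyF, hy⟩ : ∃ y ∈ F, 0 < S.mult x y := by
    by_contra! hzero
    exact (hF x hx).not_ge (Finset.sum_nonpos hzero |>.trans (Nat.zero_le _))
  have hcard : 1 < F.card :=
    Finset.one_lt_card.2 ⟨x, hx, y, hyF, by rintro rfl; exact hy.ne' (S.mult_self x)⟩
  have hsum : ∑ v ∈ F, c v + F.card ≤ ∑ v ∈ F, ∑ u ∈ F, S.mult v u := by
    rw [Finset.card_eq_sum_ones, ← Finset.sum_add_distrib]
    exact Finset.sum_le_sum hF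
  obtain ⟨z, hz⟩ := Function.ne_iff.1 hc
  have hrows (v : S.Ordinary) : ∑ u ∈ F, S.mult v u ≤ ∑ u : S.Ordinary, S.mult v u :=
    Finset.sum_le_sum_of_subset (Finset.subset_univ F)
  by_cases hzF : z ∈ F
  · have hcz : c z ≤ ∑ v ∈ F, c v := Finset.single_le_sum (fun _ _ => Nat.zero_le _) hzF
    have htotal : ∑ v ∈ F, ∑ u ∈ F, S.mult v u ≤ S.ordinaryTotal :=
      (Finset.sum_le_sum fun v _ => hrows v).trans
        (Finset.sum_le_sum_of_subset (Finset.subset_univ F))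
    have := Nat.pos_of_ne_zero hz
    omega
  · obtain ⟨z', hz'⟩ := hS.exists_mult_pos (u := z) (v := x) (by rintro rfl; exact hzF hx)
    have hz'sum : S.mult z z' ≤ ∑ u : S.Ordinary, S.mult z u :=
      Finset.single_le_sum (f := fun u : S.Ordinary => S.mult z u) (fun _ _ => Nat.zero_le _)
        (Finset.mem_univ z')
    have htotal : ∑ u : S.Ordinary, S.mult z u + ∑ v ∈ F, ∑ u ∈ F, S.mult v u ≤
        S.ordinaryTotal := by
      refine (Nat.add_le_add_left (Finset.sum_le_sum fun v _ => hrows v) _).trans ?_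
      rw [← Finset.sum_insert (f := fun v : S.Ordinary => ∑ u : S.Ordinary, S.mult v u) hzF]
      exact Finset.sum_le_sum_of_subset (Finset.subset_univ _)
    omega

end OrdinaryTotal

section Lower

variable {V : Type} [Fintype V] [DecidableEq V] {S : Sandpile V}

theorem green_le_mul_of_mult_pos {Δ : ℕ} (w : S.Ordinary) {u v : S.Ordinary}
    (hΔ : S.degree v ≤ Δ) (huv : 0 < S.mult u v) : S.green w u ≤ Δ * S.green w v := by
  have hl := laplace_green_nonneg w.2 v.2
  rw [laplace_eq_degree_mul_sub, sub_nonneg] at hl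
  have hmult : (1 : ℝ) ≤ S.mult v u := by rw [S.mult_comm]; exact_mod_cast huv
  calc S.green w u ≤ S.mult v u * S.green w u :=
        le_mul_of_one_le_left (green_nonneg w.2 u) hmult
    _ ≤ ∑ x, (S.mult v x : ℝ) * S.green w x :=
        Finset.single_le_sum (f := fun x => (S.mult v x : ℝ) * S.green w x)
          (fun x _ => mul_nonneg (Nat.cast_nonneg _) (green_nonneg w.2 x)) (Finset.mem_univ (u : V))
    _ ≤ S.degree v * S.green w v := hl
    _ ≤ Δ * S.green w v :=
        mul_le_mul_of_nonneg_right (mod_cast hΔ) (green_nonneg w.2 v)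

theorem NoForbiddenOn.green_le {Δ : ℕ} (hΔ : ∀ v : S.Ordinary, S.degree v ≤ Δ)
    {c : S.Config} (hc : S.NoForbiddenOn .univ c) (w : S.Ordinary) {u v : S.Ordinary}
    (huv : 0 < S.mult u v) :
    S.green w u ≤
      S.green w u * c u + Δ * ∑ v : S.Ordinary, S.mult u v * (S.green w v * c v) := by
  have hnonneg (v : S.Ordinary) : 0 ≤ S.green w v := green_nonneg w.2 v
  have hterm (v : S.Ordinary) : 0 ≤ (S.mult u v : ℝ) * (S.green w v * c v) :=
    mul_nonneg (Nat.cast_nonneg _) (mul_nonneg (hnonneg v) (Nat.cast_nonneg _))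
  rcases hc.pos_or_pos huv with hcu | hcv
  · exact (le_mul_of_one_le_right (hnonneg u) (mod_cast hcu)).trans (le_add_of_nonneg_right
      (mul_nonneg (Nat.cast_nonneg _) (Finset.sum_nonneg fun v _ => hterm v)))
  · have hgcv : 0 ≤ S.green w v * c v := mul_nonneg (hnonneg v) (Nat.cast_nonneg _)
    calc S.green w u ≤ Δ * S.green w v := green_le_mul_of_mult_pos w (hΔ v) huv
      _ ≤ Δ * (S.mult u v * (S.green w v * c v)) := by
          refine mul_le_mul_of_nonneg_left ?_ (Nat.cast_nonneg _)
          exact (le_mul_of_one_le_right (hnonneg v) (mod_cast hcv)).trans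
            (le_mul_of_one_le_left hgcv (mod_cast huv))
      _ ≤ Δ * ∑ v : S.Ordinary, S.mult u v * (S.green w v * c v) :=
          mul_le_mul_of_nonneg_left (Finset.single_le_sum
            (f := fun v : S.Ordinary => (S.mult u v : ℝ) * (S.green w v * c v))
            (fun v _ => hterm v) (Finset.mem_univ v)) (Nat.cast_nonneg _)
      _ ≤ _ := le_add_of_nonneg_left (mul_nonneg (hnonneg u) (Nat.cast_nonneg _))

theorem NoForbiddenOn.sum_green_le {Δ : ℕ} (hΔ : ∀ v : S.Ordinary, S.degree v ≤ Δ)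
    (hadj : ∀ u : S.Ordinary, ∃ v : S.Ordinary, 0 < S.mult u v) {c : S.Config}
    (hc : S.NoForbiddenOn .univ c) (w : S.Ordinary) :
    ∑ u : S.Ordinary, S.green w u ≤ (1 + Δ ^ 2) * weight (S.green w) c := by
  have hcol (v : S.Ordinary) :
      ∑ u : S.Ordinary, (S.mult u v : ℝ) * (S.green w v * c v) ≤ Δ * (S.green w v * c v) := by
    rw [← Finset.sum_mul]
    refine mul_le_mul_of_nonneg_right ?_ (mul_nonneg (green_nonneg w.2 v) (Nat.cast_nonneg _))
    simp only [S.mult_comm _ v]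
    exact_mod_cast (sum_ordinary_mult_le_degree (v : V) Finset.univ).trans (hΔ v)
  calc ∑ u : S.Ordinary, S.green w u
      ≤ ∑ u : S.Ordinary, (S.green w u * c u +
          Δ * ∑ v : S.Ordinary, (S.mult u v : ℝ) * (S.green w v * c v)) :=
        Finset.sum_le_sum fun u _ => hc.green_le hΔ w (hadj u).choose_spec
    _ = weight (S.green w) c +
          Δ * ∑ v : S.Ordinary, ∑ u : S.Ordinary, (S.mult u v : ℝ) * (S.green w v * c v) := by
        rw [Finset.sum_add_distrib, ← Finset.mul_sum, Finset.sum_comm, weight]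
    _ ≤ weight (S.green w) c + Δ * ∑ v : S.Ordinary, Δ * (S.green w v * c v) := by
        gcongr with v
        exact hcol v
    _ = (1 + Δ ^ 2) * weight (S.green w) c := by
        rw [← Finset.mul_sum, weight]; ring

theorem exists_transientRun (hS : S.ConnectedOffSink) {Δ : ℕ}
    (hΔ : ∀ v : S.Ordinary, S.degree v ≤ Δ)
    (hadj : ∀ u : S.Ordinary, ∃ v : S.Ordinary, 0 < S.mult u v) (v w : S.Ordinary) {k : ℕ}
    (hk : (1 + Δ ^ 2) * (k * S.green w v) < ∑ u : S.Ordinary, S.green w u) :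
    ∃ c, S.TransientRun k c ∧ weight (S.green w) c ≤ k * S.green w v := by
  have hnot {k : ℕ} (hk : (1 + Δ ^ 2) * (k * S.green w v) < ∑ u : S.Ordinary, S.green w u)
      {c : S.Config} (hc : weight (S.green w) c ≤ k * S.green w v) : ¬ S.Recurrent c := by
    intro hrec
    have hsum := hrec.noForbiddenOn.sum_green_le hΔ hadj w
    have hmul : (1 + (Δ : ℝ) ^ 2) * weight (S.green w) c ≤ (1 + Δ ^ 2) * (k * S.green w v) :=
      mul_le_mul_of_nonneg_left hc (by positivity)
    linarith
  induction k with
  | zero =>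
    have hzero : weight (S.green w) (0 : S.Config) ≤ (0 : ℕ) * S.green w v := by simp [weight_zero]
    exact ⟨0, .empty (hnot hk hzero), hzero⟩
  | succ k ih =>
    have hpos := green_pos hS w v
    obtain ⟨c, hc, hle⟩ := ih (lt_of_le_of_lt (by push_cast; gcongr; linarith) hk)
    obtain ⟨c', hr, hs⟩ := exists_relaxes_stable (c + Pi.single v 1)
    have hweight := hr.weight_le (green_sink w.2) fun x hx => laplace_green_nonneg w.2 hx
    rw [weight_add, weight_single] at hweight
    have hle' : weight (S.green w) c' ≤ (k + 1 : ℕ) * S.green w v := by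
      push_cast; linarith
    exact ⟨c', .add v hc hr hs (hnot hk hle'), hle'⟩

theorem exists_transientRun_one (ht : 2 < S.ordinaryTotal) : ∃ c, S.TransientRun 1 c := by
  have hnot {c : S.Config} (hc : ∑ u, c u ≤ 1) : ¬ S.Recurrent c := fun hrec => by
    have : S.ordinaryTotal ≤ 2 * ∑ u, c u := hrec.noForbiddenOn.sum_mult_le Finset.univ
    omega
  obtain ⟨v⟩ := nonempty_of_ordinaryTotal_pos (by omega : 0 < S.ordinaryTotal)
  obtain ⟨c, hr, hs⟩ := exists_relaxes_stable (S := S) (0 + Pi.single v 1)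
  exact ⟨c, .add v (.empty (hnot (by simp))) hr hs
    (hnot (hr.sum_le.trans (by simp [Finset.sum_pi_single'])))⟩

theorem exists_transientRun_le_mul (hS : S.ConnectedOffSink) {Δ : ℕ}
    (hΔ : ∀ v : S.Ordinary, S.degree v ≤ Δ) (ht : 2 < S.ordinaryTotal) {A : ℝ}
    (hA : A ∈ S.potentialEstimates) :
    ∃ k c, S.TransientRun k c ∧ A ≤ 2 * (1 + Δ ^ 2) * k := by
  rw [potentialEstimates_eq hS] at hA
  obtain ⟨v, w, hvw⟩ := hA
  have hpos := green_pos hS w v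
  set D : ℝ := 1 + (Δ : ℝ) ^ 2
  have hDpos : 0 < D := by positivity
  by_cases hsmall : A ≤ D * 2
  · obtain ⟨c, hc⟩ := exists_transientRun_one ht
    exact ⟨1, c, hc, by push_cast; linarith⟩
  · have hlarge : 2 < A / D := by rw [lt_div_iff₀ hDpos]; linarith
    have hceil : 2 < ⌈A / D⌉₊ := Nat.lt_ceil.2 (mod_cast hlarge)
    obtain ⟨k, hk⟩ : ∃ k, ⌈A / D⌉₊ = k + 1 := ⟨_, (Nat.sub_add_cancel (by omega)).symm⟩
    have hlt : (k : ℝ) < A / D := Nat.lt_ceil.1 (by omega)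
    have hle : A / D ≤ k + 1 := by exact_mod_cast hk ▸ Nat.le_ceil (A / D)
    have hk1 : (1 : ℝ) ≤ k := by exact_mod_cast (by omega : 1 ≤ k)
    rw [lt_div_iff₀ hDpos, hvw, lt_div_iff₀ hpos] at hlt
    rw [div_le_iff₀ hDpos] at hle
    obtain ⟨c, hc, -⟩ := exists_transientRun hS hΔ
      (hS.exists_mult_pos_of_ordinaryTotal_pos (by omega)) v w (k := k) (by linarith)
    exact ⟨k, c, hc, hle.trans (by nlinarith)⟩

end Lower

section TransienceClass

variable {V : Type} [Fintype V] [DecidableEq V] {S : Sandpile V}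

theorem TransientRun.le_tcl {k : ℕ} {c : S.Config} (h : S.TransientRun k c) : (k : ℕ∞) ≤ S.tcl :=
  le_iSup₂ (f := fun (k : ℕ) (_ : k ∈ {k : ℕ | ∃ c, S.TransientRun k c}) => (k : ℕ∞)) k ⟨c, h⟩

theorem tcl_le {K : ℕ} (h : ∀ k c, S.TransientRun k c → k ≤ K) : S.tcl ≤ K :=
  iSup₂_le fun k ⟨c, hc⟩ => by exact_mod_cast h k c hc

theorem ConnectedOffSink.tcl_eq_zero (hS : S.ConnectedOffSink) (ht : S.ordinaryTotal ≤ 2) :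
    S.tcl = 0 := by
  refine le_antisymm (tcl_le fun k c h => ?_) bot_le
  obtain rfl : c = 0 := by
    by_contra hc
    exact h.not_recurrent (hS.noForbiddenOn_of_ordinaryTotal_le ht hc).recurrent
  exact (h.eq_zero_of_zero hS).le

theorem ConnectedOffSink.mul_tcl_le (hS : S.ConnectedOffSink) {Δ : ℕ}
    (hΔ : ∀ v : S.Ordinary, S.degree v ≤ Δ) {p q : ℕ} (hq : 0 < q)
    (hA : (p : ℝ) / q ∈ upperBounds S.potentialEstimates) : (q : ℕ∞) * S.tcl ≤ Δ * p := by
  have hle (k : ℕ) (c : S.Config) (h : S.TransientRun k c) : k ≤ Δ * p / q := by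
    have hk := h.le_mul hS hΔ hA
    rw [← mul_div_assoc, le_div_iff₀ (Nat.cast_pos.2 hq)] at hk
    rw [Nat.le_div_iff_mul_le hq]
    exact_mod_cast hk
  calc (q : ℕ∞) * S.tcl ≤ q * (Δ * p / q : ℕ) := by gcongr; exact tcl_le hle
    _ ≤ Δ * p := by exact_mod_cast Nat.mul_div_le _ _

theorem ConnectedOffSink.le_mul_tcl (hS : S.ConnectedOffSink) {Δ : ℕ}
    (hΔ : ∀ v : S.Ordinary, S.degree v ≤ Δ) (ht : 2 < S.ordinaryTotal) {p q : ℕ} (hq : 0 < q)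
    (hA : (p : ℝ) / q ∈ S.potentialEstimates) :
    (p : ℕ∞) ≤ (2 * (1 + Δ ^ 2) : ℕ) * (q * S.tcl) := by
  obtain ⟨k, c, h, hle⟩ := exists_transientRun_le_mul hS hΔ ht hA
  rw [div_le_iff₀ (Nat.cast_pos.2 hq)] at hle
  have hle' : p ≤ 2 * (1 + Δ ^ 2) * (q * k) := by
    rw [mul_comm q k, ← mul_assoc]
    exact_mod_cast hle
  calc (p : ℕ∞) ≤ (2 * (1 + Δ ^ 2) : ℕ) * (q * k) := by exact_mod_cast hle'
    _ ≤ _ := by gcongr; exact h.le_tcl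

end TransienceClass

end Sandpile

/-! ## A program logic for random access machines -/

namespace RAM

/-- All registers and memory cells have absolute value less than `2 ^ b`. -/
def Bounded (b : ℕ) (s : State) : Prop :=
  (∀ x, (s.reg x).natAbs < 2 ^ b) ∧ ∀ a i, (s.mem a i).natAbs < 2 ^ b

/-- A syntactic measure such that, in a state with entries of `b` bits, every subexpression has a
value of at most `b` times its weight bits. -/
def Expr.weight : Expr → ℕ
  | .const z => 1 + z.natAbs
  | .reg _ => 1
  | .load _ i => 1 + i.weight
  | .add e f => 1 + e.weight + f.weight
  | .sub e f => 1 + e.weight + f.weight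
  | .mul e f => 1 + e.weight + f.weight
  | .div e f => 1 + e.weight + f.weight

theorem two_pow_add_two_pow_le {x y z : ℕ} (h : x + y + 1 ≤ z) : 2 ^ x + 2 ^ y ≤ 2 ^ z := by
  have hx : 2 ^ x ≤ 2 ^ (x + y) := by gcongr <;> omega
  have hy : 2 ^ y ≤ 2 ^ (x + y) := by gcongr <;> omega
  have hz : 2 ^ (x + y + 1) ≤ 2 ^ z := by gcongr; omega
  rw [pow_succ] at hz
  omega

theorem Expr.natAbs_eval_lt {b : ℕ} (hb : 1 ≤ b) {s : State} (hs : Bounded b s) (e : Expr) :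
    (e.eval s).natAbs < 2 ^ (b * e.weight) := by
  have hweight (v w : ℕ) : b * v + b * w + 1 ≤ b * (1 + v + w) := by
    rw [mul_add, mul_add]; omega
  induction e with
  | const z =>
    calc z.natAbs < 2 ^ z.natAbs := Nat.lt_two_pow_self
      _ ≤ 2 ^ (b * (1 + z.natAbs)) := by gcongr <;> nlinarith [Nat.zero_le z.natAbs]
  | reg x => simpa [Expr.eval, Expr.weight] using hs.1 x
  | load a i =>
    refine (hs.2 _ _).trans_le ?_
    gcongr
    · simp
    · exact Nat.le_mul_of_pos_right b (Nat.le_add_right 1 _)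
  | add e f he hf =>
    have := two_pow_add_two_pow_le (hweight e.weight f.weight)
    have := Int.natAbs_add_le (e.eval s) (f.eval s)
    simp only [Expr.eval, Expr.weight]
    omega
  | sub e f he hf =>
    have := two_pow_add_two_pow_le (hweight e.weight f.weight)
    have := Int.natAbs_sub_le (e.eval s) (f.eval s)
    simp only [Expr.eval, Expr.weight]
    omega
  | mul e f he hf =>
    rw [Expr.eval, Int.natAbs_mul]
    calc _ < 2 ^ (b * e.weight) * 2 ^ (b * f.weight) := Nat.mul_lt_mul'' he hf
      _ = 2 ^ (b * e.weight + b * f.weight) := (pow_add _ _ _).symm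
      _ ≤ _ := Nat.pow_le_pow_right two_pos (le_of_lt (hweight _ _))
  | div e f he _ =>
    have hdiv : (e.eval s / f.eval s).natAbs ≤ (e.eval s).natAbs := by
      zify
      exact Int.abs_ediv_le_abs _ _
    refine (hdiv.trans_lt he).trans_le (Nat.pow_le_pow_right two_pos ?_)
    have := hweight e.weight f.weight
    simp only [Expr.weight]
    omega

theorem Expr.cost_le {b : ℕ} (hb : 1 ≤ b) {s : State} (hs : Bounded b s) (e : Expr) :
    e.cost s ≤ e.weight * (1 + b * e.weight) := by
  have hword (e : Expr) : wordCost (e.eval s) ≤ 1 + b * e.weight :=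
    Nat.add_le_add_left (Nat.size_le.2 (e.natAbs_eval_lt hb hs)) 1
  have hadd {x y v w c : ℕ} (hx : x ≤ v * (1 + b * v)) (hy : y ≤ w * (1 + b * w))
      (hc : c ≤ 1 + b * (1 + v + w)) : x + y + c ≤ (1 + v + w) * (1 + b * (1 + v + w)) := by
    have hv : v * (1 + b * v) ≤ v * (1 + b * (1 + v + w)) := by gcongr; omega
    have hw : w * (1 + b * w) ≤ w * (1 + b * (1 + v + w)) := by gcongr; omega
    nlinarith
  induction e with
  | const z => exact (hword (.const z)).trans (Nat.le_mul_of_pos_left _ (Nat.le_add_right 1 _))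
  | reg x => exact (hword (.reg x)).trans (Nat.le_mul_of_pos_left _ one_pos)
  | load a i hi =>
    exact hadd hi (y := 0) (w := 0) (by simp) (hword (.load a i))
  | add e f he hf => exact hadd he hf (hword (.add e f))
  | sub e f he hf => exact hadd he hf (hword (.sub e f))
  | mul e f he hf => exact hadd he hf (hword (.mul e f))
  | div e f he hf => exact hadd he hf (hword (.div e f))

/-- A bound for the cost of one elementary instruction in a state with entries of `b` bits, if its
(at most two) expressions have weight at most `30`, which is ample for the programs below. -/
def stepCost (b : ℕ) : ℕ := 1 + 60 * (1 + b * 30)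

theorem one_le_stepCost (b : ℕ) : 1 ≤ stepCost b := Nat.le_add_right _ _

theorem Expr.cost_add_cost_le_stepCost {b : ℕ} (hb : 1 ≤ b) {s : State} (hs : Bounded b s)
    {e f : Expr} (he : e.weight ≤ 30) (hf : f.weight ≤ 30) :
    1 + e.cost s + f.cost s ≤ stepCost b := by
  have hcost {e : Expr} (he : e.weight ≤ 30) : e.cost s ≤ 30 * (1 + b * 30) :=
    (e.cost_le hb hs).trans (by gcongr)
  have := hcost he
  have := hcost hf
  unfold stepCost
  omega

theorem Expr.cost_le_stepCost {b : ℕ} (hb : 1 ≤ b) {s : State} (hs : Bounded b s) {e : Expr}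
    (he : e.weight ≤ 30) : 1 + e.cost s ≤ stepCost b :=
  (Nat.le_add_right _ _).trans (e.cost_add_cost_le_stepCost hb hs he he)

@[simp] theorem State.reg_setReg (s : State) (x y : ℕ) (z : ℤ) :
    (s.setReg x z).reg y = if y = x then z else s.reg y :=
  Function.update_apply _ _ _ _

theorem State.mem_setMem (s : State) (a i c j : ℕ) (z : ℤ) :
    (s.setMem a i z).mem c j = if c = a ∧ j = i then z else s.mem c j := by
  simp only [State.setMem, Function.update_apply]
  grind

theorem Bounded.setReg {b : ℕ} {s : State} (hs : Bounded b s) (x : ℕ) {z : ℤ}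
    (hz : z.natAbs < 2 ^ b) : Bounded b (s.setReg x z) := by
  refine ⟨fun y => ?_, hs.2⟩
  rw [State.reg_setReg]
  split_ifs
  exacts [hz, hs.1 y]

theorem Bounded.setMem {b : ℕ} {s : State} (hs : Bounded b s) (a i : ℕ) {z : ℤ}
    (hz : z.natAbs < 2 ^ b) : Bounded b (s.setMem a i z) := by
  refine ⟨hs.1, fun c j => ?_⟩
  rw [State.mem_setMem]
  split_ifs
  exacts [hz, hs.2 c j]

/-- The registers a program may change. -/
def Program.regs : Program → List ℕ
  | .skip => []
  | .assign x _ => [x]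
  | .store _ _ _ => []
  | .seq P Q => P.regs ++ Q.regs
  | .ite _ P Q => P.regs ++ Q.regs
  | .loop _ P => P.regs

/-- The banks a program may change. -/
def Program.banks : Program → List ℕ
  | .skip => []
  | .assign _ _ => []
  | .store a _ _ => [a]
  | .seq P Q => P.banks ++ Q.banks
  | .ite _ P Q => P.banks ++ Q.banks
  | .loop _ P => P.banks

/-- The states agree outside the registers `R` and the banks `B`. -/
def Agree (R B : List ℕ) (s s' : State) : Prop :=
  (∀ x, x ∉ R → s'.reg x = s.reg x) ∧ ∀ a, a ∉ B → s'.mem a = s.mem a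

theorem Agree.refl (R B : List ℕ) (s : State) : Agree R B s s := ⟨fun _ _ => rfl, fun _ _ => rfl⟩

theorem Agree.trans {R B : List ℕ} {s s' s'' : State} (h : Agree R B s s')
    (h' : Agree R B s' s'') : Agree R B s s'' :=
  ⟨fun x hx => (h'.1 x hx).trans (h.1 x hx), fun a ha => (h'.2 a ha).trans (h.2 a ha)⟩

theorem Agree.mono {R B R' B' : List ℕ} {s s' : State} (h : Agree R B s s') (hR : R ⊆ R')
    (hB : B ⊆ B') : Agree R' B' s s' :=
  ⟨fun x hx => h.1 x (mt (@hR x) hx), fun a ha => h.2 a (mt (@hB a) ha)⟩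

theorem Agree.setReg {R B : List ℕ} {s s' : State} (h : Agree R B s s') {x : ℕ} (hx : x ∈ R)
    (z : ℤ) : Agree R B s (s'.setReg x z) := by
  refine ⟨fun y hy => ?_, h.2⟩
  have hyx : y ≠ x := fun e => hy (e ▸ hx)
  simpa [hyx] using h.1 y hy

theorem Exec.agree {P : Program} {s s' : State} {t : ℕ} (h : Exec P s s' t) :
    Agree P.regs P.banks s s' := by
  induction h with
  | skip s => exact .refl _ _ _
  | assign s x e => exact (Agree.refl _ _ _).setReg (by simp [Program.regs]) _
  | store s a i e =>
    refine ⟨fun _ _ => rfl, fun c hc => ?_⟩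
    have hca : c ≠ a := by simpa [Program.banks] using hc
    simp [State.setMem, hca]
  | seq _ _ h h' =>
    exact (h.mono (by simp [Program.regs]) (by simp [Program.banks])).trans
      (h'.mono (by simp [Program.regs]) (by simp [Program.banks]))
  | ite_pos _ _ h => exact h.mono (by simp [Program.regs]) (by simp [Program.banks])
  | ite_neg _ _ h => exact h.mono (by simp [Program.regs]) (by simp [Program.banks])
  | loop_done _ => exact .refl _ _ _
  | loop_step _ _ _ h h' => exact Agree.trans h h'

/-- A Hoare triple with running time: started in the state `s`, if this is bounded, the program
`P` halts in a bounded state satisfying `Q` after at most `k` steps of cost at most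
`stepCost b`. -/
def Runs (b : ℕ) (P : Program) (s : State) (k : ℕ) (Q : State → Prop) : Prop :=
  Bounded b s → ∃ s' t, Exec P s s' t ∧ t ≤ k * stepCost b ∧ Bounded b s' ∧ Q s'

theorem Runs.mono {b : ℕ} {P : Program} {s : State} {k k' : ℕ} {Q Q' : State → Prop}
    (h : Runs b P s k Q) (hk : k ≤ k') (hQ : ∀ s', Agree P.regs P.banks s s' → Q s' → Q' s') :
    Runs b P s k' Q' := fun hs => by
  obtain ⟨s', t, he, ht, hb, hq⟩ := h hs
  exact ⟨s', t, he, ht.trans (Nat.mul_le_mul_right _ hk), hb, hQ s' he.agree hq⟩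

theorem Runs.skip {b K : ℕ} {s : State} {Q : State → Prop} (hQ : Q s)
    (hK : 1 ≤ K := by omega) : Runs b .skip s K Q := fun hs =>
  ⟨s, 1, .skip s, Nat.mul_pos hK (one_le_stepCost b), hs, hQ⟩

theorem Runs.assign {b K : ℕ} (hb : 1 ≤ b) {s : State} {x : ℕ} {e : Expr} {Q : State → Prop}
    (hw : e.weight ≤ 30) (hz : Bounded b s → (e.eval s).natAbs < 2 ^ b)
    (hQ : Q (s.setReg x (e.eval s))) (hK : 1 ≤ K := by omega) :
    Runs b (.assign x e) s K Q := fun hs =>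
  ⟨_, _, .assign s x e, (e.cost_le_stepCost hb hs hw).trans (Nat.le_mul_of_pos_left _ hK),
    hs.setReg x (hz hs), hQ⟩

theorem Runs.store {b K : ℕ} (hb : 1 ≤ b) {s : State} {a : ℕ} {i e : Expr} {Q : State → Prop}
    (hi : i.weight ≤ 30) (hw : e.weight ≤ 30) (hz : Bounded b s → (e.eval s).natAbs < 2 ^ b)
    (hQ : Q (s.setMem a (i.eval s).toNat (e.eval s))) (hK : 1 ≤ K := by omega) :
    Runs b (.store a i e) s K Q := fun hs =>
  ⟨_, _, .store s a i e,
    (i.cost_add_cost_le_stepCost hb hs hi hw).trans (Nat.le_mul_of_pos_left _ hK),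
    hs.setMem a _ (hz hs), hQ⟩

theorem Runs.seq {b K : ℕ} {P P' : Program} {s : State} (k k' : ℕ) {Q : State → Prop}
    (h : Runs b P s k fun s' => Runs b P' s' k' Q) (hK : 1 + k + k' ≤ K := by omega) :
    Runs b (.seq P P') s K Q := fun hs => by
  obtain ⟨s', t, he, ht, hb, hq⟩ := h hs
  obtain ⟨s'', t', he', ht', hb', hq'⟩ := hq hb
  refine ⟨s'', _, .seq he he', le_trans ?_ (Nat.mul_le_mul_right _ hK), hb', hq'⟩
  have := one_le_stepCost b
  rw [add_mul, add_mul]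
  omega

theorem Runs.ite {b K : ℕ} (hb : 1 ≤ b) {e : Expr} {P P' : Program} {s : State} (k : ℕ)
    {Q : State → Prop} (hw : e.weight ≤ 30) (h : 0 < e.eval s → Runs b P s k Q)
    (h' : ¬ 0 < e.eval s → Runs b P' s k Q) (hK : 1 + k ≤ K := by omega) :
    Runs b (.ite e P P') s K Q := fun hs => by
  have htest := e.cost_le_stepCost hb hs hw
  by_cases he : 0 < e.eval s
  · obtain ⟨s', t, hx, ht, hb, hq⟩ := h he hs
    refine ⟨s', _, .ite_pos he hx, le_trans ?_ (Nat.mul_le_mul_right _ hK), hb, hq⟩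
    rw [add_mul]
    omega
  · obtain ⟨s', t, hx, ht, hb, hq⟩ := h' he hs
    refine ⟨s', _, .ite_neg he hx, le_trans ?_ (Nat.mul_le_mul_right _ hK), hb, hq⟩
    rw [add_mul]
    omega

theorem Runs.loop_done {b K : ℕ} (hb : 1 ≤ b) {e : Expr} {P : Program} {s : State}
    {Q : State → Prop} (hw : e.weight ≤ 30) (he : ¬ 0 < e.eval s) (hQ : Q s)
    (hK : 1 ≤ K := by omega) : Runs b (.loop e P) s K Q := fun hs =>
  ⟨s, _, .loop_done he, (e.cost_le_stepCost hb hs hw).trans (Nat.le_mul_of_pos_left _ hK), hs, hQ⟩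

theorem Runs.loop_step {b K : ℕ} (hb : 1 ≤ b) {e : Expr} {P : Program} {s : State} (k k' : ℕ)
    {Q : State → Prop} (hw : e.weight ≤ 30) (he : 0 < e.eval s)
    (h : Runs b P s k fun s' => Runs b (.loop e P) s' k' Q) (hK : 1 + k + k' ≤ K := by omega) :
    Runs b (.loop e P) s K Q := fun hs => by
  have htest := e.cost_le_stepCost hb hs hw
  obtain ⟨s', t, hx, ht, hb, hq⟩ := h hs
  obtain ⟨s'', t', hx', ht', hb', hq'⟩ := hq hb
  refine ⟨s'', _, .loop_step he hx hx', le_trans ?_ (Nat.mul_le_mul_right _ hK), hb', hq'⟩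
  rw [add_mul, add_mul]
  omega

/-- Run `P` with register `x` counting from its present value up to the value of `e`,
exclusively. -/
def Program.countLoop (x : ℕ) (e : Expr) (P : Program) : Program :=
  .loop (.sub e (.reg x)) (.seq P (.assign x (.add (.reg x) (.const 1))))

/-- Run `P` with register `x` counting from `0` up to the value of `e`, exclusively. -/
def Program.forLoop (x : ℕ) (e : Expr) (P : Program) : Program :=
  .seq (.assign x (.const 0)) (.countLoop x e P)

section ForLoop

variable {b : ℕ} {x : ℕ} {e : Expr} {P : Program} {s : State} {N : ℕ}

theorem Runs.countLoop {I : ℕ → State → Prop} (hb : 1 ≤ b) (k : ℕ) (hN : N < 2 ^ b)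
    (hw : e.weight ≤ 20) (hx : x ∉ P.regs)
    (heval : ∀ s', Agree (x :: P.regs) P.banks s s' → e.eval s' = N)
    (hI : ∀ m s z, I m s → I m (s.setReg x z))
    (hstep : ∀ m < N, ∀ s', Agree (x :: P.regs) P.banks s s' → s'.reg x = m → I m s' →
      Runs b P s' k (I (m + 1))) (r : ℕ) {m : ℕ} {s' : State} (hm : m + r = N)
    (hA : Agree (x :: P.regs) P.banks s s') (hreg : s'.reg x = m) (h : I m s') :
    Runs b (.countLoop x e P) s' (r * (k + 3) + 1) (I N) := by
  have hwsub : (Expr.sub e (.reg x)).weight ≤ 30 := by simp only [Expr.weight]; omega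
  induction r generalizing m s' with
  | zero =>
    obtain rfl : m = N := by omega
    exact .loop_done hb hwsub (by simp only [Expr.eval, heval s' hA, hreg]; omega) h
  | succ r ih =>
    have htest : 0 < (Expr.sub e (.reg x)).eval s' := by
      simp only [Expr.eval, heval s' hA, hreg]; omega
    refine .loop_step hb (k + 2) (r * (k + 3) + 1) hwsub htest ?_ (le_of_eq (by ring))
    refine .seq k 1 ((hstep m (by omega) s' hA hreg h).mono le_rfl fun s₁ hA₁ h₁ => ?_)
    have hA₁' := hA.trans (hA₁.mono (List.subset_cons_self _ _) (List.Subset.refl _))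
    have hnext : (Expr.add (.reg x) (.const 1)).eval s₁ = ((m + 1 : ℕ) : ℤ) := by
      simp [Expr.eval, hA₁.1 x hx, hreg]
    refine .assign hb (by simp [Expr.weight]) (fun _ => by rw [hnext]; omega) ?_
    rw [hnext]
    exact ih (by omega) (hA₁'.setReg (by simp) _) (by simp) (hI _ _ _ h₁)

theorem Runs.forLoop {I : Finset (Fin N) → State → Prop} (hb : 1 ≤ b) (k : ℕ) {K : ℕ}
    (hN : N < 2 ^ b) (hw : e.weight ≤ 20) (hx : x ∉ P.regs)
    (heval : ∀ s', Agree (x :: P.regs) P.banks s s' → e.eval s' = N)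
    (hI : ∀ T s z, I T s → I T (s.setReg x z)) (h0 : I ∅ s)
    (hstep : ∀ (m : Fin N) T s', m ∉ T → Agree (x :: P.regs) P.banks s s' →
      s'.reg x = (m : ℕ) → I T s' → Runs b P s' k (I (insert m T)))
    (hK : N * (k + 3) + 3 ≤ K := by omega) : Runs b (.forLoop x e P) s K (I .univ) := by
  let initial (m : ℕ) : Finset (Fin N) := {i | (i : ℕ) < m}
  have hinsert (m : ℕ) (hm : m < N) : insert ⟨m, hm⟩ (initial m) = initial (m + 1) := by
    ext i
    simp only [initial, Finset.mem_insert, Finset.mem_filter_univ, Fin.ext_iff]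
    omega
  have huniv : initial N = .univ := by simp [initial]
  have hJstep (m : ℕ) (hm : m < N) (s' : State) (hA : Agree (x :: P.regs) P.banks s s')
      (hreg : s'.reg x = m) (h : I (initial m) s') : Runs b P s' k (I (initial (m + 1))) :=
    hinsert m hm ▸ hstep ⟨m, hm⟩ _ s' (by simp [initial]) hA hreg h
  refine .seq 1 (N * (k + 3) + 1) (.assign hb (by simp [Expr.weight])
    (fun _ => by simp [Expr.eval]) (huniv ▸ ?_))
  exact Runs.countLoop (I := fun m => I (initial m)) hb k hN hw hx heval (fun m => hI _) hJstep N
    (zero_add N) ((Agree.refl _ _ _).setReg (by simp) _) (by simp [Expr.eval])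
    (hI _ _ _ (by simpa [initial] using h0))

end ForLoop

end RAM

/-! ## Matrices in memory -/

namespace RAM

/-- The entry in row `reg x` and column `reg y` of the matrix stored row by row in bank `a`; the
size of the matrix is in register `0`. -/
def Expr.cell (a x y : ℕ) : Expr := .load a (.add (.mul (.reg x) (.reg 0)) (.reg y))

theorem Expr.eval_cell {a x y : ℕ} {s : State} {n i j : ℕ} (h0 : s.reg 0 = n) (hx : s.reg x = i)
    (hy : s.reg y = j) : (Expr.cell a x y).eval s = s.mem a (i * n + j) := by
  simp only [Expr.cell, Expr.eval, h0, hx, hy]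
  norm_cast

/-- A test that is positive if registers `x` and `y` differ, and `0` otherwise. -/
def Expr.distinct (x y : ℕ) : Expr := .mul (.sub (.reg x) (.reg y)) (.sub (.reg x) (.reg y))

theorem Expr.distinct_pos {n x y : ℕ} {s : State} {i j : Fin n} (hx : s.reg x = (i : ℕ))
    (hy : s.reg y = (j : ℕ)) : 0 < (Expr.distinct x y).eval s ↔ i ≠ j := by
  simp only [Expr.distinct, Expr.eval, hx, hy, mul_self_pos, sub_ne_zero, ne_eq, Nat.cast_inj,
    Fin.val_inj]

/-- The registers describe the cell `(i, j)` of a square matrix of size `n`: register `0` holds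
the size, registers `2`, `3` and `4` hold the index of the cell, its row and its column. -/
structure AtCell {n : ℕ} (i j : Fin n) (s : State) : Prop where
  size : s.reg 0 = n
  index : s.reg 2 = ((i * n + j : ℕ) : ℤ)
  row : s.reg 3 = (i : ℕ)
  col : s.reg 4 = (j : ℕ)

/-- Bank `a` holds the matrix `A`, row by row. -/
def Holds {n : ℕ} (s : State) (a : ℕ) (A : Matrix (Fin n) (Fin n) ℤ) : Prop :=
  ∀ i j : Fin n, s.mem a (i * n + j) = A i j

section Cells

variable {n : ℕ} {i j : Fin n} {s s' : State} {a : ℕ} {A : Matrix (Fin n) (Fin n) ℤ}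

theorem AtCell.of_agree {R B : List ℕ} (h : AtCell i j s) (hA : Agree R B s s')
    (hR : ∀ x ∈ [0, 2, 3, 4], x ∉ R) : AtCell i j s' where
  size := (hA.1 0 (hR 0 (by simp))).trans h.size
  index := (hA.1 2 (hR 2 (by simp))).trans h.index
  row := (hA.1 3 (hR 3 (by simp))).trans h.row
  col := (hA.1 4 (hR 4 (by simp))).trans h.col

theorem Holds.congr (h : Holds s a A) (he : s'.mem a = s.mem a) : Holds s' a A := fun i j => by
  rw [he, h i j]

theorem Holds.of_agree {R B : List ℕ} (h : Holds s a A) (hA : Agree R B s s') (ha : a ∉ B) :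
    Holds s' a A :=
  h.congr (hA.2 a ha)

theorem Holds.eval_load (h : Holds s a A) (hc : AtCell i j s) :
    (Expr.load a (.reg 2)).eval s = A i j := by
  simp only [Expr.eval, hc.index, Int.toNat_natCast, h i j]

theorem Holds.eval_cell (h : Holds s a A) (h0 : s.reg 0 = n) {x y : ℕ} (hx : s.reg x = (i : ℕ))
    (hy : s.reg y = (j : ℕ)) : (Expr.cell a x y).eval s = A i j :=
  (Expr.eval_cell h0 hx hy).trans (h i j)

theorem cell_lt (i j : Fin n) : (i * n + j : ℕ) < n * n := by
  nlinarith [i.isLt, j.isLt]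

theorem cell_inj {e e' : Fin n × Fin n} (h : (e.1 * n + e.2 : ℕ) = e'.1 * n + e'.2) : e = e' :=
  finProdFinEquiv.injective (Fin.ext (by simpa [mul_comm n, add_comm] using h))

end Cells

/-- Run `P` for every cell of a square matrix, with the registers as in `AtCell`. -/
def Program.forCells (P : Program) : Program :=
  .forLoop 2 (.mul (.reg 0) (.reg 0)) (.seq (.assign 3 (.div (.reg 2) (.reg 0)))
    (.seq (.assign 4 (.sub (.reg 2) (.mul (.reg 3) (.reg 0)))) P))

/-- A test that is positive if neither the row nor the column of the present cell is the one whose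
index is in register `1`. -/
def Expr.offSink : Expr := .mul (.distinct 3 1) (.distinct 4 1)

theorem Expr.offSink_pos {n : ℕ} {s : State} {i j o : Fin n} (hc : AtCell i j s)
    (ho : s.reg 1 = (o : ℕ)) : 0 < Expr.offSink.eval s ↔ i ≠ o ∧ j ≠ o := by
  rw [← Expr.distinct_pos hc.row ho, ← Expr.distinct_pos hc.col ho]
  refine ⟨fun h => ?_, fun h => mul_pos h.1 h.2⟩
  rwa [Expr.offSink, Expr.eval, mul_pos_iff, or_iff_left] at h
  exact fun h => h.1.not_ge (mul_self_nonneg _)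

/-- Run `P` for every cell of a square matrix that is neither in the row nor in the column whose
index is in register `1`. -/
def Program.forCellsOff (P : Program) : Program := .forCells (.ite .offSink P .skip)

section ForCells

variable {b n : ℕ} {P : Program} {s : State} {I : Finset (Fin n × Fin n) → State → Prop}

theorem Runs.forCells (hb : 1 ≤ b) (k : ℕ) {K : ℕ} (hn : n * n < 2 ^ b) (h0P : 0 ∉ P.regs)
    (h2P : 2 ∉ P.regs) (hs : s.reg 0 = n)
    (hI : ∀ T s z, ∀ x ∈ [2, 3, 4], I T s → I T (s.setReg x z)) (h0 : I ∅ s)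
    (hstep : ∀ i j T s', (i, j) ∉ T → Agree (2 :: 3 :: 4 :: P.regs) P.banks s s' →
      AtCell i j s' → I T s' → Runs b P s' k (I (insert (i, j) T)))
    (hK : n * n * (k + 7) + 3 ≤ K := by omega) : Runs b (.forCells P) s K (I .univ) := by
  have hsize {s' : State} (h : Agree (2 :: 3 :: 4 :: P.regs) P.banks s s') : s'.reg 0 = n :=
    (h.1 0 (by simp [h0P])).trans hs
  let cells (T : Finset (Fin (n * n))) : Finset (Fin n × Fin n) :=
    T.map finProdFinEquiv.symm.toEmbedding
  have huniv : cells .univ = .univ := Finset.map_univ_equiv _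
  refine huniv ▸ Runs.forLoop (I := fun T => I (cells T)) hb (k + 4) hn (by decide)
    (by simpa [Program.regs] using h2P) (fun s' h => ?_) (fun T s z => hI _ s z 2 (by simp)) h0
    fun m T s' hm h h2 hT => ?_
  · simp only [Expr.eval, hsize h, Nat.cast_mul]
  · replace h : Agree (2 :: 3 :: 4 :: P.regs) P.banks s s' := h
    have hlt : (m : ℕ) < 2 ^ b := m.isLt.trans hn
    have hrow : (Expr.div (.reg 2) (.reg 0)).eval s' = (m.divNat : ℕ) := by
      simp [Expr.eval, h2, hsize h]
    have hsplit : ((m.divNat * n + m.modNat : ℕ) : ℤ) = (m : ℕ) := by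
      rw [Fin.coe_divNat, Fin.coe_modNat, Nat.div_add_mod']
    have hcol : (Expr.sub (.reg 2) (.mul (.reg 3) (.reg 0))).eval
        (s'.setReg 3 (m.divNat : ℕ)) = (m.modNat : ℕ) := by
      simp only [Expr.eval, State.reg_setReg, h2, hsize h, ← hsplit]
      push_cast
      simp
    refine .seq 1 (k + 2) (.assign hb (by decide) (fun _ => ?_) (hrow ▸ .seq 1 k
      (.assign hb (by decide) (fun _ => ?_) (hcol ▸ ?_))))
    · rw [hrow, Int.natAbs_natCast]
      exact (Nat.div_le_self _ _).trans_lt hlt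
    · rw [hcol, Int.natAbs_natCast]
      exact (Nat.mod_le _ _).trans_lt hlt
    · have hinsert : cells (insert m T) = insert (m.divNat, m.modNat) (cells T) :=
        Finset.map_insert _ _ _
      refine hinsert ▸ hstep m.divNat m.modNat (cells T) _ ?_
        ((Agree.setReg h (by simp) _).setReg (by simp) _) ⟨?_, ?_, ?_, ?_⟩
        (hI _ _ _ 4 (by simp) (hI _ _ _ 3 (by simp) hT))
      · exact (Finset.mem_map' (a := m) finProdFinEquiv.symm.toEmbedding).not.2 hm
      · simp [hsize h]
      · simp only [State.reg_setReg]
        exact h2.trans hsplit.symm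
      · simp
      · simp

theorem Runs.forCellsOff (hb : 1 ≤ b) (k : ℕ) {K : ℕ} (hn : n * n < 2 ^ b) (h0P : 0 ∉ P.regs)
    (h1P : 1 ∉ P.regs) (h2P : 2 ∉ P.regs) (hs : s.reg 0 = n) {o : Fin n}
    (ho : s.reg 1 = (o : ℕ))
    (hI : ∀ T s z, ∀ x ∈ [2, 3, 4], I T s → I T (s.setReg x z)) (h0 : I ∅ s)
    (hstep : ∀ i j T s', i ≠ o → j ≠ o → (i, j) ∉ T →
      Agree (2 :: 3 :: 4 :: P.regs) P.banks s s' → AtCell i j s' → I T s' →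
      Runs b P s' k (I (insert (i, j) T)))
    (hK : n * n * (k + 9) + 3 ≤ K := by omega) :
    Runs b (.forCellsOff P) s K (I {e | e.1 ≠ o ∧ e.2 ≠ o}) := by
  have hregs : (Program.ite .offSink P .skip).regs = P.regs := by simp [Program.regs]
  have hbanks : (Program.ite .offSink P .skip).banks = P.banks := by simp [Program.banks]
  refine Runs.forCells (I := fun T => I {e ∈ T | e.1 ≠ o ∧ e.2 ≠ o}) hb (k + 2) hn
    (hregs ▸ h0P) (hregs ▸ h2P) hs (fun T => hI _) h0 fun i j T s' hT h hc hi => ?_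
  rw [hregs, hbanks] at h
  have htest := Expr.offSink_pos hc ((h.1 1 (by simp [h1P])).trans ho)
  refine .ite hb (k + 1) (by decide) (fun he => ?_) fun he => ?_ <;>
    rw [htest] at he <;> rw [Finset.filter_insert]
  · rw [if_pos he]
    exact (hstep i j _ s' he.1 he.2 (by simp [hT]) h hc hi).mono (Nat.le_succ k) fun _ _ h => h
  · rw [if_neg he]
    exact .skip hi

theorem Runs.fillCells (hb : 1 ≤ b) (k : ℕ) {K : ℕ} (hn : n * n < 2 ^ b) (h0P : 0 ∉ P.regs)
    (h2P : 2 ∉ P.regs) (hs : s.reg 0 = n) {c : ℕ} {A : Matrix (Fin n) (Fin n) ℤ}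
    (hstep : ∀ i j s', Agree (2 :: 3 :: 4 :: P.regs) P.banks s s' → AtCell i j s' →
      Runs b P s' k fun s'' => s''.mem c = Function.update (s'.mem c) (i * n + j) (A i j))
    (hK : n * n * (k + 7) + 3 ≤ K := by omega) :
    Runs b (.forCells P) s K fun s' => Holds s' c A := by
  refine (Runs.forCells (I := fun T s => ∀ e ∈ T, s.mem c (e.1 * n + e.2) = A e.1 e.2) hb k hn
    h0P h2P hs (fun _ _ _ _ _ h => h) (by simp) fun i j T s' _ h hc hT =>
      (hstep i j s' h hc).mono le_rfl fun s'' _ hmem e he => ?_).mono hK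
    fun s' _ h i j => h (i, j) (Finset.mem_univ _)
  rw [hmem, Function.update_apply]
  split_ifs with heq
  · rw [cell_inj (e' := (i, j)) heq]
  · refine hT e (Finset.mem_of_mem_insert_of_ne he ?_)
    rintro rfl
    exact heq rfl

theorem Runs.storeCell {K : ℕ} (hb : 1 ≤ b) {a : ℕ} {e : Expr} {i j : Fin n} {z : ℤ}
    (hc : AtCell i j s) (hw : e.weight ≤ 30) (he : e.eval s = z)
    (hz : Bounded b s → z.natAbs < 2 ^ b) (hK : 1 ≤ K := by omega) :
    Runs b (.store a (.reg 2) e) s K fun s' =>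
      s'.mem a = Function.update (s.mem a) (i * n + j) z := by
  refine .store hb (by decide) hw (by rwa [he]) ?_
  simp only [State.setMem, Expr.eval, hc.index, Int.toNat_natCast, he, Function.update_self]

end ForCells

theorem natAbs_sum_le_card_mul {ι : Type*} [Fintype ι] {f : ι → ℤ} {X : ℕ}
    (hX : ∀ i, (f i).natAbs ≤ X) (T : Finset ι) :
    (∑ i ∈ T, f i).natAbs ≤ Fintype.card ι * X :=
  calc (∑ i ∈ T, f i).natAbs ≤ ∑ i ∈ T, (f i).natAbs := Int.natAbs_sum_le _ _
    _ ≤ T.card * X := Finset.sum_le_card_nsmul _ _ X fun i _ => hX i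
    _ ≤ Fintype.card ι * X := by gcongr; exact T.card_le_univ

/-- Copy the matrix in bank `a` to bank `c`. -/
def Program.copy (a c : ℕ) : Program := .forCells (.store c (.reg 2) (.load a (.reg 2)))

/-- Add up the row of the matrix in bank `a` whose index is in register `3`. -/
def Program.rowSum (a : ℕ) : Program :=
  .seq (.assign 6 (.const 0)) (.forLoop 5 (.reg 0) (.assign 6 (.add (.reg 6) (.cell a 3 5))))

/-- Add up in register `10` the matrix in bank `a`, the row and the column whose index is in
register `1` being left out. -/
def Program.total (a : ℕ) : Program :=
  .seq (.assign 10 (.const 0)) (.forCellsOff (.assign 10 (.add (.reg 10) (.load a (.reg 2)))))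

section BasicPrograms

variable {b n a : ℕ} {s : State} {A : Matrix (Fin n) (Fin n) ℤ}

theorem Runs.copy {K c : ℕ} (hb : 1 ≤ b) (hac : a ≠ c) (hn : n * n < 2 ^ b) (hs : s.reg 0 = n)
    (hA : Holds s a A) (hK : n * n * 8 + 3 ≤ K := by omega) :
    Runs b (.copy a c) s K fun s' => Holds s' c A := by
  refine .fillCells hb 1 hn (by simp [Program.regs]) (by simp [Program.regs]) hs
    fun i j s' h hc => ?_
  have hA' : Holds s' a A := hA.of_agree h (by simpa [Program.banks] using hac)
  exact .storeCell hb hc (by simp [Expr.weight]) (hA'.eval_load hc) fun hB => hA' i j ▸ hB.2 _ _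

theorem Runs.rowSum {K X : ℕ} {i : Fin n} (hb : 1 ≤ b) (hn : n * n < 2 ^ b) (hs : s.reg 0 = n)
    (hi : s.reg 3 = (i : ℕ)) (hA : Holds s a A) (hX : ∀ j, (A i j).natAbs ≤ X)
    (hnX : n * X < 2 ^ b) (hK : n * 4 + 5 ≤ K := by omega) :
    Runs b (.rowSum a) s K fun s' => s'.reg 6 = ∑ j, A i j := by
  refine .seq 1 (n * 4 + 3) (.assign hb (by decide) (fun _ => by simp [Expr.eval])
    (.forLoop (I := fun T s => s.reg 6 = ∑ j ∈ T, A i j) hb 1 ((Nat.le_mul_self n).trans_lt hn)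
      (by decide) (by simp [Program.regs]) (fun s' h => ?_) (fun T s z h => by simpa using h)
      (by simp [Expr.eval]) fun j T s' hj h h5 h6 => ?_))
  · simpa [Expr.eval, hs] using h.1 0 (by simp [Program.regs])
  · have h0 : s'.reg 0 = n := by simpa [hs] using h.1 0 (by simp [Program.regs])
    have h3 : s'.reg 3 = (i : ℕ) := by simpa [hi] using h.1 3 (by simp [Program.regs])
    have hA' : Holds s' a A := hA.congr (h.2 a (by simp [Program.banks]))
    have hsum : (Expr.add (.reg 6) (.cell a 3 5)).eval s' = ∑ l ∈ insert j T, A i l := by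
      rw [Expr.eval, hA'.eval_cell h0 h3 h5, Expr.eval, h6, Finset.sum_insert hj, add_comm]
    refine .assign hb (by simp [Expr.weight, Expr.cell]) (fun _ => ?_) (by simpa using hsum)
    rw [hsum]
    exact (natAbs_sum_le_card_mul hX _).trans_lt (by simpa using hnX)

theorem Runs.total {K X : ℕ} (hb : 1 ≤ b) (hn : n * n < 2 ^ b) (hs : s.reg 0 = n) {o : Fin n}
    (ho : s.reg 1 = (o : ℕ)) (hA : Holds s a A) (hX : ∀ i j, (A i j).natAbs ≤ X)
    (hnnX : n * n * X < 2 ^ b) (hK : n * n * 10 + 5 ≤ K := by omega) :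
    Runs b (.total a) s K fun s' =>
      s'.reg 10 = ∑ e : Fin n × Fin n with e.1 ≠ o ∧ e.2 ≠ o, A e.1 e.2 := by
  refine .seq 1 (n * n * 10 + 3) (.assign hb (by decide) (fun _ => by simp [Expr.eval])
    (.forCellsOff (I := fun T s => s.reg 10 = ∑ e ∈ T, A e.1 e.2) hb 1 hn (by simp [Program.regs])
      (by simp [Program.regs]) (by simp [Program.regs]) (by simpa using hs) (by simpa using ho)
      (fun T s z x hx h => ?_) (by simp [Expr.eval]) fun i j T s' _ _ hT h hc h10 => ?_))
  · have hne : 10 ≠ x := by rintro rfl; simp at hx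
    simpa [hne] using h
  · have hA' : Holds s' a A := hA.congr (h.2 a (by simp [Program.banks]))
    have hsum : (Expr.add (.reg 10) (.load a (.reg 2))).eval s' =
        ∑ e ∈ insert (i, j) T, A e.1 e.2 := by
      rw [Expr.eval, hA'.eval_load hc, Expr.eval, h10, Finset.sum_insert hT, add_comm]
    refine .assign hb (by simp [Expr.weight]) (fun _ => ?_) (by simpa using hsum)
    rw [hsum]
    exact (natAbs_sum_le_card_mul (fun e : Fin n × Fin n => hX e.1 e.2) _).trans_lt
      (by simpa using hnnX)

end BasicPrograms

end RAM

/-! ## The program -/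

namespace RAM

/-- A fraction-free exchange step for the matrix in bank `1`; the result is written to bank `2`.
Register `7` holds the index of the pivot row and register `9` the previous pivot. -/
def Program.exchange : Program :=
  .forCells (.ite (.distinct 3 7)
    (.ite (.distinct 4 7)
      (.store 2 (.reg 2) (.div (.sub (.mul (.cell 1 7 7) (.load 1 (.reg 2)))
        (.mul (.cell 1 3 7) (.cell 1 7 4))) (.reg 9)))
      (.store 2 (.reg 2) (.load 1 (.reg 2))))
    (.ite (.distinct 4 7)
      (.store 2 (.reg 2) (.sub (.const 0) (.load 1 (.reg 2))))
      (.store 2 (.reg 2) (.reg 9))))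

/-- Replace the matrix in bank `1` by its adjugate. -/
def Program.adjugate : Program :=
  .seq (.assign 9 (.const 1)) (.forLoop 7 (.reg 0)
    (.seq .exchange (.seq (.assign 9 (.cell 1 7 7)) (.copy 2 1))))

section Adjugate

variable {b n : ℕ} {s : State} {A : Matrix (Fin n) (Fin n) ℤ}

theorem Runs.exchange {K : ℕ} (hb : 1 ≤ b) (hn : n * n < 2 ^ b) (hs : s.reg 0 = n)
    {k : Fin n} {d : ℤ} {B : Matrix (Fin n) (Fin n) ℤ} (hA : Holds s 1 A)
    (hk : s.reg 7 = (k : ℕ)) (hd : s.reg 9 = d) (hd0 : d ≠ 0) (hAB : exchangeStep A d k = d • B)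
    (hB : ∀ i j, (B i j).natAbs < 2 ^ b) (hK : n * n * 10 + 3 ≤ K := by omega) :
    Runs b .exchange s K fun s' => Holds s' 2 B := by
  refine .fillCells hb 3 hn (by decide) (by decide) hs fun i j s' h hc => ?_
  have hA' : Holds s' 1 A := hA.of_agree h (by decide)
  have hk' : s'.reg 7 = (k : ℕ) := (h.1 7 (by decide)).trans hk
  have hd' : s'.reg 9 = d := (h.1 9 (by decide)).trans hd
  have hload := hA'.eval_load hc
  have hentry : exchangeStep A d k i j = d * B i j := by rw [hAB]; rfl
  refine .ite hb 2 (by decide) (fun hi => .ite hb 1 (by decide) (fun hj => ?_) fun hj => ?_)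
    fun hi => .ite hb 1 (by decide) (fun hj => ?_) fun hj => ?_ <;>
    rw [Expr.distinct_pos hc.row hk'] at hi <;> rw [Expr.distinct_pos hc.col hk'] at hj <;>
    refine .storeCell hb hc (by decide) ?_ fun _ => hB i j
  · have hminor : A k k * A i j - A i k * A k j = d * B i j := by
      simpa [exchangeStep, hi, hj] using hentry
    simp only [Expr.eval, hA'.eval_cell hc.size hk' hk', hA'.eval_cell hc.size hc.row hk',
      hA'.eval_cell hc.size hk' hc.col, hc.index, Int.toNat_natCast, hA' i j, hd', hminor]
    exact Int.mul_ediv_cancel_left _ hd0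
  · obtain rfl := not_ne_iff.1 hj
    refine hload.trans (mul_left_cancel₀ hd0 ?_)
    simpa [exchangeStep, hi] using hentry
  · obtain rfl := not_ne_iff.1 hi
    rw [Expr.eval, hload, Expr.eval, zero_sub]
    refine mul_left_cancel₀ hd0 ?_
    simpa [exchangeStep, hj] using hentry
  · obtain rfl := not_ne_iff.1 hi
    obtain rfl := not_ne_iff.1 hj
    refine hd'.trans (mul_left_cancel₀ hd0 ?_)
    simpa [exchangeStep] using hentry

theorem Runs.adjugate {K : ℕ} (hb : 1 ≤ b) (hn : n * n < 2 ^ b) (hs : s.reg 0 = n)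
    (hA : Holds s 1 A) (hdet : ∀ T, (mixRows T A 1).det ≠ 0)
    (hbound : ∀ T i j, (partialAdjugate A T i j).natAbs < 2 ^ b)
    (hK : n * (n * n * 18 + 12) + 5 ≤ K := by omega) :
    Runs b .adjugate s K fun s' => Holds s' 1 A.adjugate := by
  have hstart : (s.setReg 9 1).reg 9 = (mixRows ∅ A 1).det := by simp [mixRows_empty]
  refine .seq 1 (n * (n * n * 18 + 12) + 3) (.assign hb (by decide)
    (fun _ => Nat.one_lt_two_pow (by omega)) (.mono (.forLoop
      (I := fun T s => Holds s 1 (partialAdjugate A T) ∧ s.reg 9 = (mixRows T A 1).det)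
      (hK := le_rfl) hb (n * n * 18 + 9) ((Nat.le_mul_self n).trans_lt hn) (by decide) (by decide)
      (fun s' h => ?_) (fun T s z h => ⟨h.1, by simpa using h.2⟩)
      ⟨by rwa [partialAdjugate_empty], hstart⟩ fun k T s' hk h h7 hT => ?_) le_rfl
      fun s' _ h => partialAdjugate_univ A ▸ h.1))
  · exact (h.1 0 (by decide)).trans hs
  · have h0 : s'.reg 0 = n := (h.1 0 (by decide)).trans hs
    refine .seq (n * n * 10 + 3) (n * n * 8 + 5) (.mono (.exchange hb hn h0 hT.1 h7 hT.2 (hdet T)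
      (exchangeStep_partialAdjugate A hk (hdet _)) (hbound _)) le_rfl fun s₁ a₁ h₁ => ?_)
    have hpivot : (Expr.cell 1 7 7).eval s₁ = (mixRows (insert k T) A 1).det := by
      rw [det_mixRows_insert A hk]
      exact (hT.1.of_agree a₁ (by decide)).eval_cell ((a₁.1 0 (by decide)).trans h0)
        ((a₁.1 7 (by decide)).trans h7) ((a₁.1 7 (by decide)).trans h7)
    refine .seq 1 (n * n * 8 + 3) (.assign hb (by decide) (fun _ => ?_) ?_)
    · rw [hpivot, det_mixRows_insert A hk]
      exact hbound T k k
    · refine .mono (.copy hb (by decide) hn ((a₁.1 0 (by decide)).trans h0) h₁) le_rfl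
        fun s₂ a₂ h₂ => ⟨h₂, ?_⟩
      rw [a₂.1 9 (by decide), hpivot]
      simp

end Adjugate

/-- The denominators `D e` with `e ∈ T` are positive, and `p / q` is the maximum of `0` and the
ratios `N e / D e`, as an unreduced fraction. -/
structure IsMaxRatio {ι : Type*} (N D : ι → ℤ) (T : Finset ι) (p q : ℤ) : Prop where
  pos : ∀ e ∈ T, 0 < D e
  num_nonneg : 0 ≤ p
  den_pos : 0 < q
  le : ∀ e ∈ T, N e * q ≤ p * D e
  attained : p = 0 ∨ ∃ e ∈ T, p = N e ∧ q = D e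

namespace IsMaxRatio

variable {ι : Type*} {N D : ι → ℤ} {T : Finset ι} {p q : ℤ}

theorem empty (N D : ι → ℤ) : IsMaxRatio N D ∅ 0 1 := ⟨by simp, le_rfl, one_pos, by simp, .inl rfl⟩

theorem insert_of_le [DecidableEq ι] (h : IsMaxRatio N D T p q) {e : ι} (hD : 0 < D e)
    (he : N e * q ≤ p * D e) : IsMaxRatio N D (insert e T) p q where
  pos := Finset.forall_mem_insert .. |>.2 ⟨hD, h.pos⟩
  num_nonneg := h.num_nonneg
  den_pos := h.den_pos
  le := Finset.forall_mem_insert .. |>.2 ⟨he, h.le⟩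
  attained := h.attained.imp_right fun ⟨e', he', h'⟩ => ⟨e', Finset.mem_insert_of_mem he', h'⟩

theorem insert_of_lt [DecidableEq ι] (h : IsMaxRatio N D T p q) {e : ι} (hD : 0 < D e)
    (he : p * D e < N e * q) : IsMaxRatio N D (insert e T) (N e) (D e) := by
  have hN : 0 < N e :=
    pos_of_mul_pos_left ((mul_nonneg h.num_nonneg hD.le).trans_lt he) h.den_pos.le
  refine ⟨Finset.forall_mem_insert .. |>.2 ⟨hD, h.pos⟩, hN.le, hD, ?_,
    .inr ⟨e, Finset.mem_insert_self e T, rfl, rfl⟩⟩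
  refine Finset.forall_mem_insert .. |>.2 ⟨le_rfl, fun e' he' => ?_⟩
  have hD' := h.pos e' he'
  refine le_of_mul_le_mul_right ?_ h.den_pos
  calc N e' * D e * q = N e' * q * D e := by ring
    _ ≤ p * D e' * D e := mul_le_mul_of_nonneg_right (h.le e' he') hD.le
    _ = p * D e * D e' := by ring
    _ ≤ N e * q * D e' := by gcongr
    _ = N e * D e' * q := by ring

theorem isGreatest (h : IsMaxRatio N D T p q) (hN : ∃ e ∈ T, 0 < N e) :
    IsGreatest ((fun e => (N e / D e : ℝ)) '' T) (p / q) := by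
  obtain ⟨e, he, hNe⟩ := hN
  have hp : p ≠ 0 := fun h0 => ((mul_pos hNe h.den_pos).trans_le (h.le e he)).ne' (by simp [h0])
  obtain ⟨e', he', rfl, rfl⟩ := h.attained.resolve_left hp
  refine ⟨⟨e', he', rfl⟩, ?_⟩
  rintro _ ⟨x, hx, rfl⟩
  have hx0 : (0 : ℝ) < D x := Int.cast_pos.2 (h.pos x hx)
  have he0 : (0 : ℝ) < D e' := Int.cast_pos.2 (h.pos e' he')
  refine (div_le_div_iff₀ hx0 he0).2 ?_
  exact_mod_cast h.le x hx

end IsMaxRatio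

/-- The numerator of the ratio of a row sum to the entry `e` of that row. Numerator and denominator
carry that entry as an additional factor, so that the denominator is positive whatever its sign. -/
def ratioNum {n : ℕ} (A : Matrix (Fin n) (Fin n) ℤ) (e : Fin n × Fin n) : ℤ :=
  (∑ j, A e.1 j) * A e.1 e.2

/-- The denominator that belongs to `ratioNum`. -/
def ratioDen {n : ℕ} (A : Matrix (Fin n) (Fin n) ℤ) (e : Fin n × Fin n) : ℤ :=
  A e.1 e.2 * A e.1 e.2

/-- Replace the fraction in the registers `11` and `12` by the ratio of register `6` to the present
entry of the matrix in bank `1`, if this is larger. -/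
def Program.updateMax : Program :=
  .ite (.sub (.mul (.mul (.reg 6) (.load 1 (.reg 2))) (.reg 12))
      (.mul (.reg 11) (.mul (.load 1 (.reg 2)) (.load 1 (.reg 2)))))
    (.seq (.assign 11 (.mul (.reg 6) (.load 1 (.reg 2))))
      (.assign 12 (.mul (.load 1 (.reg 2)) (.load 1 (.reg 2)))))
    .skip

/-- Compute in the registers `11` and `12` the maximal ratio of a row sum to an entry of that row,
for the matrix in bank `1`; only entries neither in the row nor in the column whose index is in
register `1` are taken into account. -/
def Program.maximize : Program :=
  .seq (.assign 11 (.const 0)) (.seq (.assign 12 (.const 1))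
    (.forCellsOff (.seq (.rowSum 1) .updateMax)))

section Maximize

variable {b n : ℕ} {s : State} {A : Matrix (Fin n) (Fin n) ℤ}

theorem Runs.updateMax {K : ℕ} {i j : Fin n} (hb : 1 ≤ b) (hA : Holds s 1 A) (hc : AtCell i j s)
    (h6 : s.reg 6 = ∑ l, A i l) {T : Finset (Fin n × Fin n)}
    (hN : (ratioNum A (i, j)).natAbs < 2 ^ b) (hD : (ratioDen A (i, j)).natAbs < 2 ^ b)
    (hA0 : A i j ≠ 0) (h : IsMaxRatio (ratioNum A) (ratioDen A) T (s.reg 11) (s.reg 12))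
    (hK : 4 ≤ K := by omega) :
    Runs b .updateMax s K fun s' =>
      IsMaxRatio (ratioNum A) (ratioDen A) (insert (i, j) T) (s'.reg 11) (s'.reg 12) := by
  have hDpos : 0 < ratioDen A (i, j) := mul_self_pos.2 hA0
  have hnum : (Expr.mul (.reg 6) (.load 1 (.reg 2))).eval s = ratioNum A (i, j) := by
    rw [Expr.eval, hA.eval_load hc, Expr.eval, h6, ratioNum]
  have hden (z : ℤ) : (Expr.mul (.load 1 (.reg 2)) (.load 1 (.reg 2))).eval (s.setReg 11 z) =
      ratioDen A (i, j) := by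
    rw [ratioDen, ← hA.eval_load hc]
    rfl
  have htest : (Expr.sub (.mul (.mul (.reg 6) (.load 1 (.reg 2))) (.reg 12))
      (.mul (.reg 11) (.mul (.load 1 (.reg 2)) (.load 1 (.reg 2))))).eval s =
      ratioNum A (i, j) * s.reg 12 - s.reg 11 * ratioDen A (i, j) := by
    simp only [Expr.eval, hc.index, Int.toNat_natCast, hA i j, h6, ratioNum, ratioDen]
  refine .ite hb 3 (by decide) (fun hlt => ?_) fun hlt => ?_ <;> rw [htest, sub_pos] at hlt
  · refine .seq 1 1 (.assign hb (by decide) (fun _ => hnum ▸ hN)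
      (.assign hb (by decide) (fun _ => (hden _).symm ▸ hD) ?_))
    rw [hden, hnum]
    simpa using h.insert_of_lt hDpos hlt
  · exact .skip (h.insert_of_le hDpos (not_lt.1 hlt))

theorem Runs.maximize {K Y : ℕ} {o : Fin n} (hb : 1 ≤ b) (hn : n * n < 2 ^ b) (hs : s.reg 0 = n)
    (ho : s.reg 1 = (o : ℕ)) (hA : Holds s 1 A) (hA0 : ∀ i j, i ≠ o → j ≠ o → A i j ≠ 0)
    (hY : ∀ i j, (A i j).natAbs ≤ Y) (hnY : n * Y < 2 ^ b) (hnYY : n * Y * Y < 2 ^ b)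
    (hK : n * n * (n * 4 + 19) + 7 ≤ K := by omega) :
    Runs b .maximize s K fun s' => IsMaxRatio (ratioNum A) (ratioDen A)
      {e | e.1 ≠ o ∧ e.2 ≠ o} (s'.reg 11) (s'.reg 12) := by
  have hN (e) : (ratioNum A e).natAbs < 2 ^ b := by
    have hsum := natAbs_sum_le_card_mul (hY e.1) .univ
    rw [Fintype.card_fin] at hsum
    rw [ratioNum, Int.natAbs_mul]
    exact (Nat.mul_le_mul hsum (hY _ _)).trans_lt hnYY
  have hD (e) : (ratioDen A e).natAbs < 2 ^ b := by
    rw [ratioDen, Int.natAbs_mul]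
    refine (Nat.mul_le_mul (hY _ _) (hY _ _)).trans_lt (lt_of_le_of_lt ?_ hnYY)
    exact Nat.mul_le_mul_right _ (Nat.le_mul_of_pos_left _ o.pos)
  refine .seq 1 (n * n * (n * 4 + 19) + 5) (.assign hb (by decide) (fun _ => by simp [Expr.eval])
    (.seq 1 (n * n * (n * 4 + 19) + 3) (.assign hb (by decide)
      (fun _ => Nat.one_lt_two_pow (by omega)) ?_)))
  refine .forCellsOff (P := .seq (.rowSum 1) .updateMax) (hK := le_rfl)
    (I := fun T s => IsMaxRatio (ratioNum A) (ratioDen A) T (s.reg 11) (s.reg 12))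
    hb (n * 4 + 10) hn (by decide) (by decide) (by decide) (by simpa using hs)
    (by simpa using ho) (fun T s z x hx h => ?_) ?_ fun i j T s₁ hi hj _ h hc hT => ?_
  · have h11 : 11 ≠ x := by rintro rfl; simp at hx
    have h12 : 12 ≠ x := by rintro rfl; simp at hx
    simpa [h11, h12] using h
  · simpa [Expr.eval] using IsMaxRatio.empty (ratioNum A) (ratioDen A)
  · have h0 : s₁.reg 0 = n := by simpa [hs] using h.1 0 (by decide)
    have hA₁ : Holds s₁ 1 A := hA.congr (h.2 1 (by decide))
    refine .seq (n * 4 + 5) 4 ((Runs.rowSum hb hn h0 hc.row hA₁ (hY i) hnY).mono le_rfl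
      fun s₂ a₂ h6 => ?_)
    rw [← a₂.1 11 (by decide), ← a₂.1 12 (by decide)] at hT
    exact .updateMax hb (hA₁.of_agree a₂ (by decide)) (hc.of_agree a₂ (by decide)) h6
      (hN _) (hD _) (hA0 i j hi hj) hT

end Maximize

end RAM

namespace Sandpile

variable {n : ℕ}

/-- The adjacency matrix, with multiplicities, in the form in which the machine holds it. -/
def adjacency (S : Sandpile (Fin n)) : Matrix (Fin n) (Fin n) ℤ := fun i j => S.mult i j

theorem sum_adjacency_row (S : Sandpile (Fin n)) (i : Fin n) :
    ∑ j, S.adjacency i j = S.degree i :=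
  (Nat.cast_sum _ _).symm

theorem sum_adjacency_off_sink (S : Sandpile (Fin n)) :
    ∑ e : Fin n × Fin n with e.1 ≠ S.sink ∧ e.2 ≠ S.sink, S.adjacency e.1 e.2 =
      S.ordinaryTotal := by
  let V : Finset (Fin n) := {v | v ≠ S.sink}
  have hmem (v : Fin n) : v ∈ V ↔ v ≠ S.sink := by simp [V]
  have hprod : ({e | e.1 ≠ S.sink ∧ e.2 ≠ S.sink} : Finset (Fin n × Fin n)) = V ×ˢ V := by
    ext
    simp [V]
  rw [hprod, Finset.sum_product, ordinaryTotal, Finset.sum_subtype _ hmem, Nat.cast_sum]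
  refine Finset.sum_congr rfl fun u _ => ?_
  rw [Finset.sum_subtype _ hmem, Nat.cast_sum]
  rfl

theorem natAbs_reducedLaplacian_le (S : Sandpile (Fin n)) {X : ℕ} (hX : ∀ i j, S.mult i j ≤ X)
    (hX1 : 1 ≤ X) (i j : Fin n) : (S.reducedLaplacian i j).natAbs ≤ n * X := by
  have hn : X ≤ n * X := Nat.le_mul_of_pos_left X i.pos
  have hdegree : S.degree i ≤ n * X := by
    simpa [degree] using Finset.sum_le_card_nsmul Finset.univ (S.mult i) X fun j _ => hX i j
  unfold reducedLaplacian
  split_ifs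
  · simpa using hX1.trans hn
  · simp
  · simpa using hdegree
  · simpa using (hX i j).trans hn

end Sandpile

namespace RAM

/-- Compute in bank `1` the reduced Laplacian of the graph whose adjacency matrix is in bank `0`
and whose sink is in register `1`. -/
def Program.laplacian : Program :=
  .forCells (.seq (.rowSum 0) (.ite .offSink
    (.ite (.distinct 3 4) (.store 1 (.reg 2) (.sub (.const 0) (.load 0 (.reg 2))))
      (.store 1 (.reg 2) (.reg 6)))
    (.ite (.distinct 3 4) (.store 1 (.reg 2) (.const 0)) (.store 1 (.reg 2) (.const 1)))))

theorem Runs.laplacian {b n K X : ℕ} {s : State} {S : Sandpile (Fin n)} (hb : 1 ≤ b)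
    (hn : n * n < 2 ^ b) (hs : s.reg 0 = n) (ho : s.reg 1 = (S.sink : ℕ))
    (hA : Holds s 0 S.adjacency) (hX : ∀ i j, S.mult i j ≤ X) (hX1 : 1 ≤ X)
    (hnX : n * X < 2 ^ b) (hK : n * n * (n * 4 + 16) + 3 ≤ K := by omega) :
    Runs b .laplacian s K fun s' => Holds s' 1 S.reducedLaplacian := by
  refine .fillCells (hK := hK) hb (n * 4 + 9) hn (by decide) (by decide) hs fun i j s' h hc => ?_
  have hA' : Holds s' 0 S.adjacency := hA.of_agree h (by decide)
  refine .seq (n * 4 + 5) 3 ((Runs.rowSum hb hn hc.size hc.row hA' (hX i) hnX).mono le_rfl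
    fun s₁ a₁ h6 => ?_)
  rw [S.sum_adjacency_row] at h6
  have hc₁ : AtCell i j s₁ := hc.of_agree a₁ (by decide)
  have hA₁ : Holds s₁ 0 S.adjacency := hA'.of_agree a₁ (by decide)
  have ho₁ : s₁.reg 1 = (S.sink : ℕ) :=
    (a₁.1 1 (by decide)).trans ((h.1 1 (by decide)).trans ho)
  have hmem : s₁.mem 1 = s'.mem 1 := a₁.2 1 (by decide)
  rw [← hmem]
  refine .ite hb 2 (by decide) (fun hi => .ite hb 1 (by decide) (fun hj => ?_) fun hj => ?_)
    fun hi => .ite hb 1 (by decide) (fun hj => ?_) fun hj => ?_ <;>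
    rw [Expr.offSink_pos hc₁ ho₁, ← not_or] at hi <;>
    rw [Expr.distinct_pos hc₁.row hc₁.col] at hj <;>
    refine .storeCell hb hc₁ (by decide) ?_
      fun _ => (S.natAbs_reducedLaplacian_le hX hX1 i j).trans_lt hnX
  · rw [Expr.eval, hA₁.eval_load hc₁, Expr.eval, zero_sub, Sandpile.reducedLaplacian,
      if_neg hi, if_neg hj]
    rfl
  · rw [Expr.eval, h6, Sandpile.reducedLaplacian, if_neg hi, if_pos (not_ne_iff.1 hj)]
  · rw [Expr.eval, Sandpile.reducedLaplacian, if_pos (not_not.1 hi), if_neg hj]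
  · rw [Expr.eval, Sandpile.reducedLaplacian, if_pos (not_not.1 hi), if_pos (not_ne_iff.1 hj)]

end RAM

namespace RAM

/-- Write the fraction in the registers `11` and `12` to the registers `0` and `1` if the number in
register `10` is larger than `2`, and the fraction `0 / 1` otherwise. -/
def Program.select : Program :=
  .ite (.sub (.reg 10) (.const 2))
    (.seq (.assign 0 (.reg 11)) (.assign 1 (.reg 12)))
    (.seq (.assign 0 (.const 0)) (.assign 1 (.const 1)))

theorem Runs.select {b K : ℕ} {s : State} (hb : 1 ≤ b) {t : ℕ} (h10 : s.reg 10 = t)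
    (hK : 4 ≤ K := by omega) :
    Runs b .select s K fun s' =>
      (2 < t → s'.reg 0 = s.reg 11 ∧ s'.reg 1 = s.reg 12) ∧
      (t ≤ 2 → s'.reg 0 = 0 ∧ s'.reg 1 = 1) := by
  have htest : 0 < (Expr.sub (.reg 10) (.const 2)).eval s ↔ 2 < t := by
    rw [Expr.eval, Expr.eval, Expr.eval, h10, sub_pos]
    exact Nat.cast_lt (α := ℤ) (m := 2)
  refine .ite hb 3 (by decide) (fun h => ?_) (fun h => ?_) <;> rw [htest] at h
  · exact .seq 1 1 (.assign hb (by decide) (fun hB => hB.1 11)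
      (.assign hb (by decide) (fun hB => hB.1 12) ⟨fun _ => by simp [Expr.eval],
        fun h' => absurd h h'.not_gt⟩))
  · exact .seq 1 1 (.assign hb (by decide) (fun _ => by simp [Expr.eval])
      (.assign hb (by decide) (fun _ => Nat.one_lt_two_pow (by omega))
        ⟨fun h' => absurd h' h, fun _ => by simp [Expr.eval]⟩))

/-- Compute the maximum of the potential estimates of a sandpile as a fraction in the registers `0`
and `1`; if the multigraph of the ordinary vertices has at most one edge, the transience class
vanishes and the result is `0 / 1`. -/
def Program.transience : Program :=
  .seq (.total 0) (.seq .laplacian (.seq .adjugate (.seq .maximize .select)))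

end RAM

/-! ## Correctness and running time -/

namespace Sandpile

section Potentials

variable {n : ℕ} {S : Sandpile (Fin n)}

theorem adjugate_eq_det_mul_green (v w : Fin n) :
    (S.reducedLaplacian.adjugate v w : ℝ) = S.reducedLaplacian.det * S.green v w := by
  rw [green_comm, green, mul_div_cancel₀]
  exact Int.cast_ne_zero.2 det_reducedLaplacian_ne_zero

theorem adjugate_ne_zero (hS : S.ConnectedOffSink) {v w : Fin n} (hv : v ≠ S.sink)
    (hw : w ≠ S.sink) : S.reducedLaplacian.adjugate v w ≠ 0 := by
  rw [← Int.cast_ne_zero (α := ℝ), adjugate_eq_det_mul_green]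
  exact mul_ne_zero (Int.cast_ne_zero.2 det_reducedLaplacian_ne_zero)
    (green_pos hS ⟨v, hv⟩ ⟨w, hw⟩).ne'

theorem ratio_adjugate (hS : S.ConnectedOffSink) (w v : S.Ordinary) :
    (RAM.ratioNum S.reducedLaplacian.adjugate (w, v) : ℝ) /
        RAM.ratioDen S.reducedLaplacian.adjugate (w, v) =
      (∑ u : S.Ordinary, S.green w u) / S.green w v := by
  have hdet : (S.reducedLaplacian.det : ℝ) ≠ 0 := Int.cast_ne_zero.2 det_reducedLaplacian_ne_zero
  have hadj : (S.reducedLaplacian.adjugate w v : ℝ) ≠ 0 :=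
    Int.cast_ne_zero.2 (adjugate_ne_zero hS w.2 v.2)
  rw [RAM.ratioNum, RAM.ratioDen, Int.cast_mul, Int.cast_mul, mul_div_mul_right _ _ hadj,
    Int.cast_sum]
  simp only [adjugate_eq_det_mul_green]
  rw [← Finset.mul_sum, mul_div_mul_left _ _ hdet, Fintype.sum_eq_add_sum_subtype_ne _ S.sink,
    green_sink w.2, zero_add]

theorem isGreatest_potentialEstimates (hS : S.ConnectedOffSink) [Nonempty S.Ordinary] {p q : ℤ}
    (h : RAM.IsMaxRatio (RAM.ratioNum S.reducedLaplacian.adjugate)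
      (RAM.ratioDen S.reducedLaplacian.adjugate) {e | e.1 ≠ S.sink ∧ e.2 ≠ S.sink} p q) :
    IsGreatest S.potentialEstimates (p / q) := by
  obtain ⟨w⟩ := ‹Nonempty S.Ordinary›
  have hpos : 0 < (∑ u : S.Ordinary, S.green w u) / S.green w w :=
    div_pos (Finset.sum_pos (fun u _ => green_pos hS w u) ⟨w, Finset.mem_univ w⟩)
      (green_pos hS w w)
  have hw : ((w : Fin n), (w : Fin n)) ∈
      ({e | e.1 ≠ S.sink ∧ e.2 ≠ S.sink} : Finset (Fin n × Fin n)) := by simp [w.2]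
  rw [← ratio_adjugate hS, div_pos_iff_of_pos_right (Int.cast_pos.2 (h.pos _ hw)),
    Int.cast_pos] at hpos
  convert h.isGreatest ⟨_, hw, hpos⟩ using 1
  rw [potentialEstimates_eq hS]
  ext r
  constructor
  · rintro ⟨v, w, rfl⟩
    exact ⟨(w, v), by simp [v.2, w.2], ratio_adjugate hS w v⟩
  · rintro ⟨⟨w, v⟩, he, rfl⟩
    obtain ⟨hw, hv⟩ := (Finset.mem_filter.1 he).2
    exact ⟨⟨v, hv⟩, ⟨w, hw⟩, ratio_adjugate hS ⟨w, hw⟩ ⟨v, hv⟩⟩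

end Potentials

end Sandpile

theorem RAM.Runs.transience {b n X Y : ℕ} {s : State} {S : Sandpile (Fin n)}
    (hS : S.ConnectedOffSink) (hb : 1 ≤ b) (hs : s.reg 0 = n) (ho : s.reg 1 = (S.sink : ℕ))
    (hA : Holds s 0 S.adjacency) (hX : ∀ i j, S.mult i j ≤ X) (hX1 : 1 ≤ X)
    (hnnX : n * n * X < 2 ^ b)
    (hY : ∀ T i j, (partialAdjugate S.reducedLaplacian T i j).natAbs ≤ Y)
    (hnYY : n * Y * Y < 2 ^ b) :
    Runs b .transience s (26 * n ^ 3 + 45 * n ^ 2 + 12 * n + 28) fun s' =>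
      (2 < S.ordinaryTotal → IsMaxRatio (ratioNum S.reducedLaplacian.adjugate)
        (ratioDen S.reducedLaplacian.adjugate) {e | e.1 ≠ S.sink ∧ e.2 ≠ S.sink}
        (s'.reg 0) (s'.reg 1)) ∧
      (S.ordinaryTotal ≤ 2 → s'.reg 0 = 0 ∧ s'.reg 1 = 1) := by
  have hnX : n * X < 2 ^ b := (Nat.mul_le_mul_right _ (Nat.le_mul_self n)).trans_lt hnnX
  have hnn : n * n < 2 ^ b := (Nat.le_mul_of_pos_right _ hX1).trans_lt hnnX
  have hYnY : Y ≤ n * Y := Nat.le_mul_of_pos_left Y S.sink.pos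
  have hnY : n * Y < 2 ^ b := by
    refine lt_of_le_of_lt ?_ hnYY
    rw [mul_assoc]
    exact Nat.mul_le_mul_left n (Nat.le_mul_self Y)
  refine .seq (n * n * 10 + 5)
    (n * n * (n * 4 + 16) + (n * (n * n * 18 + 12) + (n * n * (n * 4 + 19) + 22)))
    ((Runs.total hb hnn hs ho hA (fun i j => by simpa [Sandpile.adjacency] using hX i j) hnnX).mono
      le_rfl fun s₁ a₁ h10 => ?_) (by ring_nf; rfl)
  rw [S.sum_adjacency_off_sink] at h10
  have hs₁ : s₁.reg 0 = n := (a₁.1 0 (by decide)).trans hs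
  have ho₁ : s₁.reg 1 = (S.sink : ℕ) := (a₁.1 1 (by decide)).trans ho
  refine .seq (n * n * (n * 4 + 16) + 3) (n * (n * n * 18 + 12) + (n * n * (n * 4 + 19) + 18))
    ((Runs.laplacian hb hnn hs₁ ho₁ (hA.of_agree a₁ (by decide)) hX hX1 hnX).mono le_rfl
      fun s₂ a₂ hL => ?_)
  refine .seq (n * (n * n * 18 + 12) + 5) (n * n * (n * 4 + 19) + 12)
    ((Runs.adjugate hb hnn ((a₂.1 0 (by decide)).trans hs₁) hL
      Sandpile.det_mixRows_reducedLaplacian_ne_zero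
      fun T i j => ((hY T i j).trans hYnY).trans_lt hnY).mono le_rfl fun s₃ a₃ hadj => ?_)
  refine .seq (n * n * (n * 4 + 19) + 7) 4
    ((Runs.maximize hb hnn ((a₃.1 0 (by decide)).trans ((a₂.1 0 (by decide)).trans hs₁))
      ((a₃.1 1 (by decide)).trans ((a₂.1 1 (by decide)).trans ho₁)) hadj
      (fun i j hi hj => Sandpile.adjugate_ne_zero hS hi hj)
      (fun i j => partialAdjugate_univ S.reducedLaplacian ▸ hY .univ i j) hnY hnYY).mono le_rfl
      fun s₄ a₄ hmax => ?_)
  have h10₄ : s₄.reg 10 = S.ordinaryTotal := by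
    rw [a₄.1 10 (by decide), a₃.1 10 (by decide), a₂.1 10 (by decide), h10]
  refine (Runs.select hb h10₄).mono le_rfl fun s₅ _ h => ⟨fun ht => ?_, h.2⟩
  rw [(h.1 ht).1, (h.1 ht).2]
  exact hmax

namespace Sandpile

section Input

variable {n : ℕ} {S : Sandpile (Fin n)}

theorem le_inputSize : n ≤ S.inputSize := by
  have hentries : n * n ≤ ∑ i, ∑ j, RAM.wordCost (S.mult i j) := by
    simpa [RAM.wordCost] using Finset.sum_le_sum fun i (_ : i ∈ Finset.univ) =>
      Finset.sum_le_sum fun j (_ : j ∈ Finset.univ) =>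
        Nat.le_add_right 1 (S.mult i j : ℤ).natAbs.size
  exact (Nat.le_mul_self n).trans (hentries.trans (Nat.le_add_left _ _))

theorem mult_lt_two_pow_inputSize (i j : Fin n) : S.mult i j < 2 ^ S.inputSize := by
  refine (Nat.lt_size_self _).trans_le (Nat.pow_le_pow_right two_pos ?_)
  calc (S.mult i j).size ≤ RAM.wordCost (S.mult i j) := Nat.le_add_left _ _
    _ ≤ ∑ j, RAM.wordCost (S.mult i j) :=
      Finset.single_le_sum (f := fun j => RAM.wordCost (S.mult i j)) (fun _ _ => Nat.zero_le _)
        (Finset.mem_univ j)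
    _ ≤ ∑ i, ∑ j, RAM.wordCost (S.mult i j) :=
      Finset.single_le_sum (f := fun i => ∑ j, RAM.wordCost (S.mult i j))
        (fun _ _ => Nat.zero_le _) (Finset.mem_univ i)
    _ ≤ S.inputSize := Nat.le_add_left _ _

/-- A bound for the lengths of the numbers that occur in the computation, for an input of
length `I`. -/
def bitBound (I : ℕ) : ℕ := 6 * I ^ 2 + 7 * I + 1

theorem one_le_bitBound (I : ℕ) : 1 ≤ bitBound I := Nat.le_add_left _ _

theorem le_bitBound (I : ℕ) : I ≤ bitBound I := by
  unfold bitBound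
  omega

theorem bounded_input : RAM.Bounded (bitBound S.inputSize) S.input := by
  have hpow : 2 ^ S.inputSize ≤ 2 ^ bitBound S.inputSize :=
    Nat.pow_le_pow_right two_pos (le_bitBound _)
  have hn : n < 2 ^ S.inputSize := le_inputSize.trans_lt Nat.lt_two_pow_self
  refine ⟨fun x => ?_, fun a k => ?_⟩ <;> simp only [input] <;> split_ifs
  · simpa using hn.trans_le hpow
  · simpa using (S.sink.isLt.trans hn).trans_le hpow
  · simp
  · simpa using (mult_lt_two_pow_inputSize _ _).trans_le hpow
  · simp

theorem holds_input : RAM.Holds S.input 0 S.adjacency := by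
  intro i j
  have hdiv : Fin.divNat ⟨(i * n + j : ℕ), RAM.cell_lt i j⟩ = i := by
    ext
    simp [Fin.divNat, mul_comm _ n, Nat.mul_add_div i.pos, Nat.div_eq_of_lt]
  have hmod : Fin.modNat ⟨(i * n + j : ℕ), RAM.cell_lt i j⟩ = j := by
    ext
    simp [Fin.modNat, mul_comm _ n, Nat.mod_eq_of_lt]
  simp only [input, adjacency, RAM.cell_lt i j, true_and, dif_pos, hdiv, hmod]

theorem natAbs_partialAdjugate_reducedLaplacian_le (T : Finset (Fin n)) (i j : Fin n) :
    (partialAdjugate S.reducedLaplacian T i j).natAbs ≤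
      2 ^ (3 * S.inputSize ^ 2 + 3 * S.inputSize) := by
  set I := S.inputSize
  have hn : n ≤ 2 ^ I := le_inputSize.trans Nat.lt_two_pow_self.le
  have hentry (i j : Fin n) : |S.reducedLaplacian i j| ≤ 2 ^ (2 * I) := by
    rw [Int.abs_eq_natAbs, two_mul, pow_add]
    exact_mod_cast (S.natAbs_reducedLaplacian_le (fun i j => (mult_lt_two_pow_inputSize i j).le)
      Nat.one_le_two_pow i j).trans (Nat.mul_le_mul_right _ hn)
  have hfactorial : n.factorial ≤ 2 ^ (I * I) := by
    calc n.factorial ≤ n ^ n := n.factorial_le_pow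
      _ ≤ (2 ^ I) ^ n := by gcongr
      _ ≤ (2 ^ I) ^ I := Nat.pow_le_pow_right (Nat.two_pow_pos _) le_inputSize
      _ = 2 ^ (I * I) := (pow_mul 2 I I).symm
  have hpow : (2 ^ (2 * I)) ^ n ≤ 2 ^ (2 * I * I) := by
    rw [pow_mul 2 (2 * I)]
    exact Nat.pow_le_pow_right (Nat.two_pow_pos _) le_inputSize
  have hle := abs_partialAdjugate_le (one_le_pow₀ one_le_two) hentry T i j
  rw [Fintype.card_fin, Int.abs_eq_natAbs] at hle
  calc (partialAdjugate S.reducedLaplacian T i j).natAbs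
      ≤ n * (2 ^ (2 * I) * (n.factorial * (2 ^ (2 * I)) ^ n)) := by exact_mod_cast hle
    _ ≤ 2 ^ I * (2 ^ (2 * I) * (2 ^ (I * I) * 2 ^ (2 * I * I))) := by gcongr
    _ = 2 ^ (3 * I ^ 2 + 3 * I) := by ring

theorem runs_transience (hS : S.ConnectedOffSink) :
    RAM.Runs (bitBound S.inputSize) .transience S.input
      (26 * n ^ 3 + 45 * n ^ 2 + 12 * n + 28) fun s =>
      (2 < S.ordinaryTotal → RAM.IsMaxRatio (RAM.ratioNum S.reducedLaplacian.adjugate)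
        (RAM.ratioDen S.reducedLaplacian.adjugate) {e | e.1 ≠ S.sink ∧ e.2 ≠ S.sink}
        (s.reg 0) (s.reg 1)) ∧
      (S.ordinaryTotal ≤ 2 → s.reg 0 = 0 ∧ s.reg 1 = 1) := by
  set I := S.inputSize
  have hn : n ≤ 2 ^ I := le_inputSize.trans Nat.lt_two_pow_self.le
  have hY := natAbs_partialAdjugate_reducedLaplacian_le (S := S)
  set Y := 2 ^ (3 * I ^ 2 + 3 * I)
  refine .transience hS (one_le_bitBound I) rfl rfl holds_input
    (fun i j => (mult_lt_two_pow_inputSize i j).le) Nat.one_le_two_pow ?_ hY ?_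
  · calc n * n * 2 ^ I ≤ 2 ^ I * 2 ^ I * 2 ^ I := by gcongr
      _ = 2 ^ (3 * I) := by ring
      _ < 2 ^ bitBound I := Nat.pow_lt_pow_right one_lt_two (by unfold bitBound; omega)
  · calc n * Y * Y ≤ 2 ^ I * Y * Y := by gcongr
      _ = 2 ^ (6 * I ^ 2 + 7 * I) := by ring
      _ < 2 ^ bitBound I := Nat.pow_lt_pow_right one_lt_two (Nat.lt_succ_self _)

/-- The running time of `RAM.Program.transience`, in terms of the length of the input. -/
noncomputable def runningTime : Polynomial ℕ :=
  (26 * .X ^ 3 + 45 * .X ^ 2 + 12 * .X + 28) * (1 + 60 * (1 + (6 * .X ^ 2 + 7 * .X + 1) * 30))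

theorem eval_runningTime (I : ℕ) : runningTime.eval I =
    (26 * I ^ 3 + 45 * I ^ 2 + 12 * I + 28) * RAM.stepCost (bitBound I) := by
  simp [runningTime, RAM.stepCost, bitBound]

theorem exists_exec_transience (hS : S.ConnectedOffSink) :
    ∃ (s : RAM.State) (t : ℕ) (p q : ℕ),
      RAM.Exec .transience S.input s t ∧ t ≤ runningTime.eval S.inputSize ∧
      s.reg 0 = p ∧ s.reg 1 = q ∧ 0 < q ∧
      (2 < S.ordinaryTotal → IsGreatest S.potentialEstimates ((p : ℝ) / q)) ∧
      (S.ordinaryTotal ≤ 2 → p = 0) := by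
  obtain ⟨s, t, hexec, ht, -, hmax, hsmall⟩ := runs_transience hS bounded_input
  have htime : t ≤ runningTime.eval S.inputSize := by
    have hn := S.le_inputSize
    rw [eval_runningTime]
    exact ht.trans (by gcongr)
  rcases le_or_gt S.ordinaryTotal 2 with hle | hlt
  · exact ⟨s, t, 0, 1, hexec, htime, (hsmall hle).1, (hsmall hle).2, one_pos,
      fun h => absurd hle h.not_ge, fun _ => rfl⟩
  · have hpq := hmax hlt
    have := nonempty_of_ordinaryTotal_pos (two_pos.trans hlt)
    obtain ⟨p, hp⟩ := Int.eq_ofNat_of_zero_le hpq.num_nonneg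
    obtain ⟨q, hq⟩ := Int.eq_ofNat_of_zero_le hpq.den_pos.le
    rw [hp, hq] at hpq
    exact ⟨s, t, p, q, hexec, htime, hp, hq, Int.natCast_pos.1 hpq.den_pos,
      fun _ => by simpa only [Int.cast_natCast] using isGreatest_potentialEstimates hS hpq,
      fun h => absurd h hlt.not_ge⟩

end Input

end Sandpile

theorem mainTheorem4 :
    ∃ (P : RAM.Program) (T : Polynomial ℕ), ∀ Δ : ℕ, ∃ C : ℕ, 0 < C ∧
      ∀ (n : ℕ) (S : Sandpile (Fin n)),
        S.ConnectedOffSink → (∀ v : S.Ordinary, S.degree v ≤ Δ) →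
        ∃ (s : RAM.State) (t : ℕ) (p q : ℕ),
          RAM.Exec P S.input s t ∧ t ≤ T.eval S.inputSize ∧
          s.reg 0 = p ∧ s.reg 1 = q ∧ 0 < q ∧
          (q : ℕ∞) * S.tcl ≤ C * p ∧ (p : ℕ∞) ≤ C * (q * S.tcl) ∧
          (0 < S.tcl → IsGreatest S.potentialEstimates ((p : ℝ) / q)) := by
  refine ⟨.transience, Sandpile.runningTime, fun Δ => ⟨2 * (1 + Δ ^ 2), by positivity, ?_⟩⟩
  intro n S hS hΔ
  obtain ⟨s, t, p, q, hexec, ht, hp, hq, hq0, hmax, hsmall⟩ := Sandpile.exists_exec_transience hS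
  refine ⟨s, t, p, q, hexec, ht, hp, hq, hq0, ?_⟩
  rcases le_or_gt S.ordinaryTotal 2 with hle | hlt
  · simp [hS.tcl_eq_zero hle, hsmall hle]
  · have hA := hmax hlt
    have hC : (Δ : ℕ∞) ≤ (2 * (1 + Δ ^ 2) : ℕ) := Nat.cast_le.2 (by nlinarith)
    exact ⟨(hS.mul_tcl_le hΔ hq0 hA.2).trans (by gcongr), hS.le_mul_tcl hΔ hlt hq0 hA.1,
      fun _ => hA⟩
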